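/- Graphs are finite, simple and have at least one node; a graph property is a class of graphs invariant under isomorphism. Let $\mathcal W_0$ be the set of symmetric measurable functions $W:[0,1]^2\to[0,1]$. For $W\in\mathcal W_0$, the $W$-random graph $\mathbb G(k,W)$ on $\{1,\dots,k\}$ is obtained by choosing independent uniform points $x_1,\dots,x_k\in[0,1]$ and then connecting each pair $i\ne j$ with probability $W(x_i,x_j)$, independently for different pairs. For a graph $F$ on $\{1,\dots,k\}$ put $$t_{\rm ind}(F,W)=\int_{[0,1]^k}\prod_{ij\in E(F)}W(x_i,x_j)\prod_{ij\notin E(F),\,i\neq j}\bigl(1-W(x_i,x_j)\bigr)\,dx ,$$ where the products are over unordered pairs. For a graph $G$ on $\{1,\dots,n\}$ let $W_G\in\mathcal W_0$ be $1$ on $(\frac{i-1}n,\frac in]\times(\frac{j-1}n,\frac jn]$ for $ij\in E(G)$ and $0$ elsewhere. Let $\|U\|_\square=\sup_{S,T}\bigl|\int_{S\times T}U\bigr|$ over measurable $S,T\subseteq[0,1]$, and $\delta_\square(U,W)=\inf_\varphi\|U-W^\varphi\|_\square$, where $\varphi$ ranges over the invertible measure preserving maps of $[0,1]$ and $W^\varphi(x,y)=W(\varphi(x),\varphi(y))$.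 The closure $\overline{\mathcal P}$ of a graph property $\mathcal P$ is the set of all $W\in\mathcal W_0$ for which there are graphs $G_n\in\mathcal P$ with $|V(G_n)|\to\infty$ and $\delta_\square(W_{G_n},W)\to0$. The edit distance of two graphs on the same node set is $|E(G)\triangle E(H)|$; the edit distance of $G$ from $\mathcal P$ is the minimum of $|E(G)\triangle E(H)|$ over the graphs $H\in\mathcal P$ on $V(G)$ ($\infty$ if there are none), and $d_1(G,\mathcal P)$ is this distance divided by $|V(G)|^2$. The property $\mathcal P$ is hereditary if it is closed under taking induced subgraphs. It is testable if there is a graph property $\mathcal P'$ such that (i) if $G\in\mathcal P$, then for all $1\le k\le|V(G)|$ at least a fraction $2/3$ of the $k$-node induced subgraphs of $G$ are in $\mathcal P'$; and (ii) for every $\varepsilon>0$ there is a $k_\varepsilon\ge1$ such that if the edit distance of $G$ from $\mathcal P$ is at least $\varepsilon|V(G)|^2$, then for all $k_\varepsilon\le k\le|V(G)|$ at most a fraction $1/3$ of the $k$-node induced subgraphs of $G$ are in $\mathcal P'$. (a) If $\mathcal P$ is a hereditary graph property, then $\overline{\mathcal P}$ consists of those $W\in\mathcal W_0$ for which $\mathsf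 P(\mathbb G(k,W)\notin\mathcal P)=0$ for every $k\ge1$. Equivalently, it consists of those $W\in\mathcal W_0$ for which $t_{\rm ind}(F,W)=0$ for every graph $F\notin\mathcal P$. (b) If $\mathcal P$ is a testable graph property, then $\overline{\mathcal P}$ consists of those $W\in\mathcal W_0$ for which $\mathsf E\bigl(d_1(\mathbb G(k,W),\mathcal P)\bigr)\to0$ as $k\to\infty$. -/

import Mathlib

open MeasureTheory Filter Topology
open scoped ENNReal unitInterval

noncomputable section

/-- A graph property: a class of finite simple graphs that is invariant under isomorphism. -/
structure GraphProperty where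
  Holds : ∀ {V : Type} [Finite V], SimpleGraph V → Prop
  iso_invariant : ∀ {V V' : Type} [Finite V] [Finite V'] {G : SimpleGraph V}
    {G' : SimpleGraph V'}, Nonempty (G ≃g G') → Holds G → Holds G'

namespace GraphProperty

/-- Every induced subgraph (with at least one node) of a graph with the property has the
property. Graphs are understood to have at least one node. -/
def Hereditary (P : GraphProperty) : Prop :=
  ∀ {V : Type} [Finite V] (G : SimpleGraph V), P.Holds G →
    ∀ S : Set V, S.Nonempty → P.Holds (G.induce S)

end GraphProperty

/-- The edit distance `|E(G) △ E(H)|` of two graphs on the same node set. -/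
def editDist {V : Type} (G H : SimpleGraph V) : ℕ :=
  (symmDiff G.edgeSet H.edgeSet).ncard

/-- The edit distance of a graph from a property, infinite if no graph on the same node set
has the property. -/
def editDistTo {V : Type} [Finite V] (G : SimpleGraph V) (P : GraphProperty) : ℝ≥0∞ :=
  ⨅ (H : SimpleGraph V) (_ : P.Holds H), (editDist G H : ℝ≥0∞)

/-- The normalized edit distance `d₁(G, P)` of a graph from a property. -/
def d1To {V : Type} [Finite V] (G : SimpleGraph V) (P : GraphProperty) : ℝ≥0∞ :=
  editDistTo G P / (Nat.card V : ℝ≥0∞) ^ 2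

/-- The fraction of the `k`-node induced subgraphs of `G` that have property `P`. -/
def inducedFraction {V : Type} [Finite V] (k : ℕ) (G : SimpleGraph V) (P : GraphProperty) : ℝ :=
  ({S : Set V | S.ncard = k ∧ P.Holds (G.induce S)}.ncard : ℝ) /
    ({S : Set V | S.ncard = k}.ncard : ℝ)

/-- `P'` is a test property for `P`. -/
def IsTestProperty (P P' : GraphProperty) : Prop :=
  (∀ {V : Type} [Finite V] (G : SimpleGraph V), P.Holds G →
    ∀ k : ℕ, 1 ≤ k → k ≤ Nat.card V → 2 / 3 ≤ inducedFraction k G P') ∧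
  (∀ ε : ℝ, 0 < ε → ∃ kε : ℕ, 1 ≤ kε ∧
    ∀ {V : Type} [Finite V] (G : SimpleGraph V),
      ENNReal.ofReal (ε * (Nat.card V : ℝ) ^ 2) ≤ editDistTo G P →
      ∀ k : ℕ, kε ≤ k → k ≤ Nat.card V → inducedFraction k G P' ≤ 1 / 3)

/-- (Obliviously) testable graph properties. -/
def GraphProperty.Testable (P : GraphProperty) : Prop :=
  ∃ P' : GraphProperty, IsTestProperty P P'

/-- The set `𝓦₀` of symmetric measurable functions `[0,1]² → [0,1]`. -/
structure GraphFun where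
  toFun : I → I → ℝ
  measurable : Measurable (fun p : I × I => toFun p.1 p.2)
  symm : ∀ x y, toFun x y = toFun y x
  nonneg : ∀ x y, 0 ≤ toFun x y
  le_one : ∀ x y, toFun x y ≤ 1

/-- The induced density `t_ind(F, W)`; the products run over unordered pairs `{i, j}`. -/
def tInd {k : ℕ} (F : SimpleGraph (Fin k)) (W : GraphFun) : ℝ :=
  open Classical in
  ∫ x : Fin k → I,
    (∏ p : Fin k × Fin k with p.1 < p.2 ∧ F.Adj p.1 p.2, W.toFun (x p.1) (x p.2)) *
    (∏ p : Fin k × Fin k with p.1 < p.2 ∧ ¬ F.Adj p.1 p.2, (1 - W.toFun (x p.1) (x p.2)))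

/-- The sample space for the `W`-random graph on `k` nodes: independent uniform random points
of `[0,1]`, one for every node and one for every (unordered) pair of nodes. -/
abbrev SampleSpace (k : ℕ) : Type := (Fin k → I) × (Sym2 (Fin k) → I)

/-- The `W`-random graph `𝔾(k, W)`. Given the random points `x₁, …, x_k`, distinct nodes
`i, j` are connected with probability `W(x_i, x_j)`, independently for different pairs. -/
def randomGraph (k : ℕ) (W : GraphFun) (ω : SampleSpace k) : SimpleGraph (Fin k) where
  Adj i j := i ≠ j ∧ (ω.2 s(i, j) : ℝ) < W.toFun (ω.1 i) (ω.1 j)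
  symm := ⟨fun i j h => ⟨h.1.symm, by rw [Sym2.eq_swap, W.symm]; exact h.2⟩⟩
  loopless := ⟨fun _ h => h.1 rfl⟩

/-- The points `(x, y)` with `x ∈ ((i-1)/n, i/n]` and `y ∈ ((j-1)/n, j/n]` for some edge `ij`
of `G`; here the nodes are numbered from `0`. -/
def edgeRegion {n : ℕ} (G : SimpleGraph (Fin n)) : Set (I × I) :=
  {p | ∃ i j : Fin n, G.Adj i j ∧
    (p.1 : ℝ) ∈ Set.Ioc ((i : ℝ) / n) (((i : ℝ) + 1) / n) ∧
    (p.2 : ℝ) ∈ Set.Ioc ((j : ℝ) / n) (((j : ℝ) + 1) / n)}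

theorem measurableSet_edgeRegion {n : ℕ} (G : SimpleGraph (Fin n)) :
    MeasurableSet (edgeRegion G) := by
  have h : edgeRegion G = ⋃ (i : Fin n) (j : Fin n) (_ : G.Adj i j),
      ((fun p : I × I => (p.1 : ℝ)) ⁻¹' Set.Ioc ((i : ℝ) / n) (((i : ℝ) + 1) / n) ∩
       (fun p : I × I => (p.2 : ℝ)) ⁻¹' Set.Ioc ((j : ℝ) / n) (((j : ℝ) + 1) / n)) := by
    ext p
    simp only [edgeRegion, Set.mem_ofPred_eq, Set.mem_iUnion, Set.mem_inter_iff, Set.mem_preimage,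
      exists_prop]
  rw [h]
  refine MeasurableSet.iUnion fun i => MeasurableSet.iUnion fun j => MeasurableSet.iUnion fun _ => ?_
  exact ((measurable_subtype_coe.comp measurable_fst) measurableSet_Ioc).inter
    ((measurable_subtype_coe.comp measurable_snd) measurableSet_Ioc)

theorem edgeRegion_swap {n : ℕ} (G : SimpleGraph (Fin n)) (x y : I) :
    (x, y) ∈ edgeRegion G ↔ (y, x) ∈ edgeRegion G := by
  constructor <;> rintro ⟨i, j, h, hi, hj⟩ <;> exact ⟨j, i, h.symm, hj, hi⟩

/-- The function `W_G` of a graph `G`. -/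
def ofGraph {n : ℕ} (G : SimpleGraph (Fin n)) : GraphFun :=
  open Classical in
  { toFun := fun x y => if (x, y) ∈ edgeRegion G then 1 else 0
    measurable := Measurable.ite (measurableSet_edgeRegion G) measurable_const measurable_const
    symm := fun x y => if_congr (edgeRegion_swap G x y) rfl rfl
    nonneg := fun x y => by split_ifs <;> norm_num
    le_one := fun x y => by split_ifs <;> norm_num }

/-- The cut norm: the supremum of `|∫_{S × T} U|` over measurable `S, T ⊆ [0,1]`. -/
def cutNorm (U : I → I → ℝ) : ℝ :=
  sSup {r : ℝ | ∃ S T : Set I, MeasurableSet S ∧ MeasurableSet T ∧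
    r = |∫ p in S ×ˢ T, U p.1 p.2|}

/-- The distance `δ_□(U, W)`: the infimum of `‖U - W^φ‖_□` over invertible measure preserving
maps `φ : [0,1] → [0,1]`, where `W^φ(x, y) = W(φ(x), φ(y))`. -/
def cutDist (U W : GraphFun) : ℝ :=
  sInf {r : ℝ | ∃ φ : I ≃ᵐ I, MeasurePreserving φ (volume : Measure I) (volume : Measure I) ∧
    r = cutNorm fun x y => U.toFun x y - W.toFun (φ x) (φ y)}

/-- The closure of a graph property: the limits `W` of sequences of graphs with the property
whose numbers of nodes tend to infinity. -/
def GraphProperty.closure (P : GraphProperty) : Set GraphFun :=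
  {W | ∃ (N : ℕ → ℕ) (G : (m : ℕ) → SimpleGraph (Fin (N m))),
    (∀ m, P.Holds (G m)) ∧ Tendsto N atTop atTop ∧
    Tendsto (fun m => cutDist (ofGraph (G m)) W) atTop (𝓝 0)}

end

noncomputable section

/-! ### Resampling coordinates of a product measure -/

/-! Two transfers between graphs and their limits carry both parts. The counting lemma
(`abs_tInd_sub_tInd_le_cutDist`) makes induced densities, hence the law of the random graph on a
fixed number of nodes, Lipschitz in the cut distance. The sampling lemma
(`eventually_volume_real_cutNorm_le`) says that a large `W`-random graph, suitably relabeled, is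
with high probability close to `W` in cut norm.

The sampling lemma is proved directly, without regularity partitions. Relabeling sorts the sample
points, so that the point with index `i` lies near `i/k`. The difference between the graph and `W`
then has two parts. The edge noise is centred given the points; Cauchy-Schwarz bounds its cut norm
by a sum over 4-cycles whose expectation is only of order `k ^ 3` out of `k ^ 4`. The remainder is
small in L¹, by comparison with a continuous approximation of `W`.

For hereditary `P`, a random map into a graph of `P` can induce a graph outside `P` only if it is
not injective, which has probability at most `k ^ 2 / n`; by counting, forbidden densities vanish in
the limit. Conversely, if the samples lie in `P` almost surely, the sampling lemma makes them a
sequence converging to `W`.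

For testable `P`, a small expected edit distance gives, by Markov, samples near `W` with a member of
`P` nearby, and few edits change the cut norm little. Conversely, if `W` is a limit of `P`, then
`k`-node samples of `W` pass the test with probability at least 2/3. A large sample of `W` is close
to `W`, so its own `k`-node subgraphs pass more often than 1/3, and the soundness of the test at one
fixed `k` makes its edit distance small. -/

theorem measurePreserving_update {ι α : Type*} [Fintype ι] [DecidableEq ι] [MeasurableSpace α]
    (μ : Measure α) [IsProbabilityMeasure μ] (i : ι) :
    MeasurePreserving (fun p : (ι → α) × α => Function.update p.1 i p.2)
      ((Measure.pi fun _ => μ).prod μ) (Measure.pi fun _ => μ) := by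
  have hm : Measurable (fun p : (ι → α) × α => Function.update p.1 i p.2) := by
    refine measurable_pi_iff.2 fun j => ?_
    by_cases h : j = i
    · subst h; simpa using measurable_snd
    · simp only [Function.update_of_ne h]
      fun_prop
  refine ⟨hm, (Measure.pi_eq fun s hs => ?_).symm⟩
  rw [Measure.map_apply hm (MeasurableSet.univ_pi hs)]
  have hpre : (fun p : (ι → α) × α => Function.update p.1 i p.2) ⁻¹' Set.univ.pi s =
      (Set.univ.pi (Function.update s i Set.univ)) ×ˢ s i := by
    ext p
    simp only [Set.mem_preimage, Set.mem_univ_pi, Set.mem_prod]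
    constructor
    · refine fun h => ⟨fun j => ?_, by simpa using h i⟩
      by_cases hj : j = i
      · subst hj; simp
      · simpa [Function.update_of_ne hj] using h j
    · rintro ⟨h, hi⟩ j
      by_cases hj : j = i
      · subst hj; simpa using hi
      · simpa [Function.update_of_ne hj] using h j
  rw [hpre, Measure.prod_prod, Measure.pi_pi, ← Finset.prod_erase_mul _ _ (Finset.mem_univ i),
    ← Finset.prod_erase_mul Finset.univ (fun i => μ (s i)) (Finset.mem_univ i)]
  simp only [Function.update_self, measure_univ, mul_one]
  congr 1
  exact Finset.prod_congr rfl fun j hj => by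
    rw [Function.update_of_ne (Finset.ne_of_mem_erase hj)]

/-- Fubini in a form suited to dependent products: coordinates `i` and `j` can be averaged first,
with all others frozen. -/
theorem measurePreserving_update_update {ι α : Type*} [Fintype ι] [DecidableEq ι]
    [MeasurableSpace α] (μ : Measure α) [IsProbabilityMeasure μ] (i j : ι) :
    MeasurePreserving
      (fun z : (ι → α) × α × α => Function.update (Function.update z.1 i z.2.1) j z.2.2)
      ((Measure.pi fun _ => μ).prod (μ.prod μ)) (Measure.pi fun _ => μ) :=
  ((measurePreserving_update μ j).comp
    ((measurePreserving_update μ i).prod (MeasurePreserving.id μ))).comp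
    (measurePreserving_prodAssoc (Measure.pi fun _ : ι => μ) μ μ).symm

theorem integrable_of_abs_le {α : Type*} [MeasurableSpace α] {μ : Measure α} [IsFiniteMeasure μ]
    {f : α → ℝ} (hf : Measurable f) (C : ℝ) (h : ∀ x, |f x| ≤ C) : Integrable f μ :=
  Integrable.of_bound hf.aestronglyMeasurable C (Eventually.of_forall fun x => h x)

theorem abs_integral_le_of_abs_le {α : Type*} [MeasurableSpace α] {μ : Measure α}
    [IsProbabilityMeasure μ] {f : α → ℝ} {C : ℝ} (h : ∀ x, |f x| ≤ C) : |∫ x, f x ∂μ| ≤ C := by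
  simpa using norm_integral_le_of_norm_le_const (μ := μ) (f := f) (C := C)
    (Eventually.of_forall fun x => h x)

/-! ### The cut norm -/

/-- Boundedness is needed because the real `sSup` of a set that is unbounded above is 0. -/
theorem abs_setIntegral_le_cutNorm {U : I → I → ℝ} {C : ℝ} (hC : ∀ x y, |U x y| ≤ C) {S T : Set I}
    (hS : MeasurableSet S) (hT : MeasurableSet T) :
    |∫ p in S ×ˢ T, U p.1 p.2| ≤ cutNorm U := by
  refine le_csSup ⟨C, ?_⟩ ⟨S, T, hS, hT, rfl⟩
  rintro r ⟨S, T, -, -, rfl⟩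
  have hC0 : 0 ≤ C := (abs_nonneg _).trans (hC 0 0)
  refine (norm_setIntegral_le_of_norm_le_const (f := fun p : I × I => U p.1 p.2)
    (measure_lt_top _ _) (fun p _ => hC p.1 p.2)).trans ?_
  exact mul_le_of_le_one_right hC0 measureReal_le_one

theorem cutNorm_le {U : I → I → ℝ} {c : ℝ}
    (h : ∀ S T : Set I, MeasurableSet S → MeasurableSet T → |∫ p in S ×ˢ T, U p.1 p.2| ≤ c) :
    cutNorm U ≤ c :=
  csSup_le ⟨_, ∅, ∅, .empty, .empty, rfl⟩ fun _ ⟨S, T, hS, hT, hr⟩ => hr ▸ h S T hS hT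

theorem cutNorm_nonneg (U : I → I → ℝ) : 0 ≤ cutNorm U :=
  Real.sSup_nonneg fun _ ⟨_, _, _, _, h⟩ => h ▸ abs_nonneg _

theorem integral_indicator_lt (a : ℝ) (h0 : 0 ≤ a) (h1 : a ≤ 1) :
    ∫ s : I, Set.indicator {s : I | (s : ℝ) < a} 1 s = a := by
  have : {s : I | (s : ℝ) < a} = Set.Iio (⟨a, h0, h1⟩ : I) := by
    ext s; exact Iff.rfl
  rw [this, integral_indicator_one measurableSet_Iio, measureReal_def, unitInterval.volume_Iio,
    ENNReal.toReal_ofReal h0]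

/-- Layer cake: `a x` is the measure of the levels `s < a x`, and likewise for `b`. The integral is
therefore an average, over pairs of levels, of integrals of `U` over products of superlevel sets. -/
theorem abs_integral_mul_mul_le_cutNorm {U : I → I → ℝ}
    (hU : Measurable fun p : I × I => U p.1 p.2) {C : ℝ} (hC : ∀ x y, |U x y| ≤ C)
    {a b : I → ℝ} (ha : Measurable a) (hb : Measurable b)
    (ha0 : ∀ x, 0 ≤ a x) (ha1 : ∀ x, a x ≤ 1) (hb0 : ∀ x, 0 ≤ b x) (hb1 : ∀ x, b x ≤ 1) :
    |∫ p : I × I, U p.1 p.2 * (a p.1 * b p.2)| ≤ cutNorm U := by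
  let A : Set (I × I) := {p | (p.1 : ℝ) < a p.2}
  let B : Set (I × I) := {p | (p.1 : ℝ) < b p.2}
  have hA : MeasurableSet A := measurableSet_lt (by fun_prop) (by fun_prop)
  have hB : MeasurableSet B := measurableSet_lt (by fun_prop) (by fun_prop)
  let f : I × I → I × I → ℝ := fun p q =>
    U p.1 p.2 * (A.indicator 1 (q.1, p.1) * B.indicator 1 (q.2, p.2))
  have hf : Measurable (Function.uncurry f) := by
    refine (hU.comp measurable_fst).mul (Measurable.mul ?_ ?_)
    · exact (measurable_one.indicator hA).comp
        (g := A.indicator (1 : I × I → ℝ)) (f := fun z : (I × I) × I × I => (z.2.1, z.1.1))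
        (by fun_prop)
    · exact (measurable_one.indicator hB).comp
        (g := B.indicator (1 : I × I → ℝ)) (f := fun z : (I × I) × I × I => (z.2.2, z.1.2))
        (by fun_prop)
  have hC0 : 0 ≤ C := (abs_nonneg _).trans (hC 0 0)
  have hind : ∀ (S : Set (I × I)) p, |S.indicator (1 : I × I → ℝ) p| ≤ 1 := fun S p => by
    by_cases h : p ∈ S <;> simp [h]
  have hfi : Integrable (Function.uncurry f) ((volume : Measure (I × I)).prod volume) := by
    refine integrable_of_abs_le hf C fun z => ?_
    simp only [Function.uncurry, f, abs_mul]
    refine (mul_le_mul (hC _ _) (mul_le_one₀ (hind _ _) (abs_nonneg _) (hind _ _))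
      (by positivity) hC0).trans (mul_one C).le
  have h1 : ∀ p : I × I, ∫ q, f p q = U p.1 p.2 * (a p.1 * b p.2) := fun p => by
    have := integral_prod_mul (μ := (volume : Measure I)) (ν := (volume : Measure I))
      (fun s => A.indicator (1 : I × I → ℝ) (s, p.1)) (fun s => B.indicator (1 : I × I → ℝ) (s, p.2))
    simp only [f]
    rw [integral_const_mul]
    congr 1
    refine this.trans ?_
    congr 1
    · exact integral_indicator_lt _ (ha0 _) (ha1 _)
    · exact integral_indicator_lt _ (hb0 _) (hb1 _)
  calc |∫ p : I × I, U p.1 p.2 * (a p.1 * b p.2)| = |∫ p, ∫ q, f p q| := by simp_rw [h1]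
    _ = |∫ q, ∫ p, f p q| := by rw [integral_integral_swap hfi]
    _ ≤ cutNorm U := abs_integral_le_of_abs_le fun q => ?_
  have hS : MeasurableSet {x : I | (q.1 : ℝ) < a x} := measurableSet_lt (by fun_prop) ha
  have hT : MeasurableSet {x : I | (q.2 : ℝ) < b x} := measurableSet_lt (by fun_prop) hb
  have h2 : ∫ p, f p q = ∫ p in {x : I | (q.1 : ℝ) < a x} ×ˢ {x : I | (q.2 : ℝ) < b x},
      U p.1 p.2 := by
    rw [← integral_indicator (hS.prod hT)]
    refine integral_congr_ae (Eventually.of_forall fun p => ?_)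
    by_cases h1 : (q.1 : ℝ) < a p.1 <;> by_cases h2 : (q.2 : ℝ) < b p.2 <;>
      simp [f, A, B, Set.indicator, h1, h2]
  rw [h2]
  exact abs_setIntegral_le_cutNorm hC hS hT

/-! ### The counting lemma -/

/-- The factor of the pair `p` in the integrand of the induced density of `F`. -/
def pairFactor {k : ℕ} (F : SimpleGraph (Fin k)) (W : GraphFun) (p : Fin k × Fin k) (x y : I) : ℝ :=
  open Classical in if F.Adj p.1 p.2 then W.toFun x y else 1 - W.toFun x y

theorem tInd_eq_integral_prod {k : ℕ} (F : SimpleGraph (Fin k)) (W : GraphFun) :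
    tInd F W = ∫ x : Fin k → I,
      ∏ p : Fin k × Fin k with p.1 < p.2, pairFactor F W p (x p.1) (x p.2) := by
  classical
  unfold tInd pairFactor
  congr 1
  ext x
  rw [Finset.prod_ite, Finset.filter_filter, Finset.filter_filter]

theorem measurable_pairFactor {k : ℕ} (F : SimpleGraph (Fin k)) (W : GraphFun)
    (p : Fin k × Fin k) : Measurable fun z : I × I => pairFactor F W p z.1 z.2 := by
  unfold pairFactor
  split_ifs
  exacts [W.measurable, W.measurable.const_sub 1]

theorem pairFactor_nonneg {k : ℕ} (F : SimpleGraph (Fin k)) (W : GraphFun)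
    (p : Fin k × Fin k) (x y : I) : 0 ≤ pairFactor F W p x y := by
  have := W.nonneg x y
  have := W.le_one x y
  unfold pairFactor
  split_ifs <;> linarith

theorem pairFactor_le_one {k : ℕ} (F : SimpleGraph (Fin k)) (W : GraphFun)
    (p : Fin k × Fin k) (x y : I) : pairFactor F W p x y ≤ 1 := by
  have := W.nonneg x y
  have := W.le_one x y
  unfold pairFactor
  split_ifs <;> linarith

/-- A single edge function, multiplied by `[0,1]`-valued functions of other pairs, is controlled
by the cut norm. -/
theorem abs_integral_mul_prod_le_cutNorm {ι : Type*} [Fintype ι] [DecidableEq ι] {i j : ι}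
    (hij : i ≠ j) {U : I → I → ℝ}
    (hU : Measurable fun p : I × I => U p.1 p.2) {C : ℝ} (hC : ∀ x y, |U x y| ≤ C)
    (E : Finset (ι × ι)) (hE : ∀ q ∈ E, q ≠ (i, j) ∧ q ≠ (j, i))
    (w : ι × ι → I → I → ℝ) (hw : ∀ q, Measurable fun p : I × I => w q p.1 p.2)
    (hw0 : ∀ q x y, 0 ≤ w q x y) (hw1 : ∀ q x y, w q x y ≤ 1) :
    |∫ x : ι → I, U (x i) (x j) * ∏ q ∈ E, w q (x q.1) (x q.2)| ≤ cutNorm U := by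
  classical
  let g : (ι → I) → ℝ := fun x => U (x i) (x j) * ∏ q ∈ E, w q (x q.1) (x q.2)
  have hwx : ∀ q, Measurable fun x : ι → I => w q (x q.1) (x q.2) := fun q =>
    (hw q).comp (f := fun x : ι → I => (x q.1, x q.2)) (by fun_prop)
  have hg : Measurable g := by
    refine Measurable.mul (hU.comp (f := fun x : ι → I => (x i, x j)) (by fun_prop)) ?_
    exact Finset.measurable_prod _ fun q _ => hwx q
  have hgC : ∀ x, |g x| ≤ C := fun x => by
    have h0 : 0 ≤ ∏ q ∈ E, w q (x q.1) (x q.2) := Finset.prod_nonneg fun q _ => hw0 _ _ _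
    have h1 : ∏ q ∈ E, w q (x q.1) (x q.2) ≤ 1 :=
      Finset.prod_le_one (fun q _ => hw0 _ _ _) fun q _ => hw1 _ _ _
    simp only [g, abs_mul, abs_of_nonneg h0]
    exact (mul_le_of_le_one_right (abs_nonneg _) h1).trans (hC _ _)
  let r : (ι → I) × I × I → (ι → I) :=
    fun z => Function.update (Function.update z.1 i z.2.1) j z.2.2
  have hr : MeasurePreserving r := measurePreserving_update_update (volume : Measure I) i j
  have h1 : ∫ x, g x = ∫ x : ι → I, ∫ st : I × I, g (r (x, st)) := by
    have h2 := integral_map (μ := volume) hr.measurable.aemeasurable (f := g)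
      hg.aestronglyMeasurable
    rw [hr.map_eq] at h2
    rw [h2]
    exact integral_prod _ (integrable_of_abs_le (μ := (volume : Measure (ι → I)).prod (volume : Measure (I × I)))
      (hg.comp hr.measurable) C fun z => hgC _)
  change |∫ x, g x| ≤ _
  rw [h1]
  refine abs_integral_le_of_abs_le fun x => ?_
  -- With the other coordinates frozen, no factor sees both resampled points, since `hE` excludes
  -- the pair `ij` in both orders. Factors touching `j` go into `b`, all others into `a`.
  let a : I → ℝ := fun s => ∏ q ∈ E with ¬(q.1 = j ∨ q.2 = j),
    w q (Function.update x i s q.1) (Function.update x i s q.2)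
  let b : I → ℝ := fun t => ∏ q ∈ E with (q.1 = j ∨ q.2 = j),
    w q (Function.update x j t q.1) (Function.update x j t q.2)
  have hgr : ∀ st : I × I, g (r (x, st)) = U st.1 st.2 * (a st.1 * b st.2) := fun st => by
    simp only [g, r, a, b]
    rw [← Finset.prod_filter_mul_prod_filter_not E (fun q => q.1 = j ∨ q.2 = j), mul_comm (∏ q ∈ E with ¬ _, _)]
    congr 1
    · simp [Function.update_of_ne hij]
    congr 1
    · refine Finset.prod_congr rfl fun q hq => ?_
      obtain ⟨hqE, hq⟩ := Finset.mem_filter.1 hq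
      have hne := hE q hqE
      have key : ∀ l, l ≠ i → Function.update (Function.update x i st.1) j st.2 l =
          Function.update x j st.2 l := fun l hl => by
        by_cases h : l = j
        · subst h; simp
        · simp [Function.update_of_ne h, Function.update_of_ne hl]
      rw [key, key]
      · rintro rfl
        rcases hq with h | h
        · exact hne.2 (Prod.ext h rfl)
        · exact hij h
      · rintro rfl
        rcases hq with h | h
        · exact hij h
        · exact hne.1 (Prod.ext rfl h)
    · refine Finset.prod_congr rfl fun q hq => ?_
      obtain ⟨hqE, hq⟩ := Finset.mem_filter.1 hq
      push Not at hq
      rw [Function.update_of_ne hq.1, Function.update_of_ne hq.2]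
  have hm : ∀ (l : ι) (q : ι × ι), Measurable fun s : I =>
      w q (Function.update x l s q.1) (Function.update x l s q.2) := fun l q =>
    (hwx q).comp (measurable_update x)
  simp_rw [hgr]
  exact abs_integral_mul_mul_le_cutNorm hU hC
    (Finset.measurable_prod _ fun q _ => hm i q) (Finset.measurable_prod _ fun q _ => hm j q)
    (fun _ => Finset.prod_nonneg fun q _ => hw0 _ _ _)
    (fun _ => Finset.prod_le_one (fun q _ => hw0 _ _ _) fun q _ => hw1 _ _ _)
    (fun _ => Finset.prod_nonneg fun q _ => hw0 _ _ _)
    (fun _ => Finset.prod_le_one (fun q _ => hw0 _ _ _) fun q _ => hw1 _ _ _)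

theorem cutNorm_neg (U : I → I → ℝ) : cutNorm (fun x y => -U x y) = cutNorm U := by
  unfold cutNorm
  simp only [integral_neg, abs_neg]

/-- Telescoping: the factors of `W` are replaced by those of `U` one pair at a time. Each
replacement costs at most one cut norm (a non-edge only flips the sign of the difference), and there
are at most `k ^ 2` pairs. -/
theorem abs_tInd_sub_tInd_le_cutNorm {k : ℕ} (F : SimpleGraph (Fin k)) (U W : GraphFun) :
    |tInd F U - tInd F W| ≤ k ^ 2 * cutNorm fun x y => U.toFun x y - W.toFun x y := by
  classical
  set c := cutNorm fun x y => U.toFun x y - W.toFun x y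
  let E : Finset (Fin k × Fin k) := Finset.univ.filter fun p => p.1 < p.2
  let w : Finset (Fin k × Fin k) → Fin k × Fin k → I → I → ℝ := fun D q =>
    if q ∈ D then pairFactor F U q else pairFactor F W q
  have hwm : ∀ D q, Measurable fun p : I × I => w D q p.1 p.2 := fun D q => by
    simp only [w]; split_ifs <;> exact measurable_pairFactor _ _ _
  have hw0 : ∀ D q x y, 0 ≤ w D q x y := fun D q x y => by
    simp only [w]; split_ifs <;> exact pairFactor_nonneg _ _ _ _ _
  have hw1 : ∀ D q x y, w D q x y ≤ 1 := fun D q x y => by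
    simp only [w]; split_ifs <;> exact pairFactor_le_one _ _ _ _ _
  let t : Finset (Fin k × Fin k) → ℝ := fun D =>
    ∫ x : Fin k → I, ∏ q ∈ E, w D q (x q.1) (x q.2)
  have hti : ∀ D, Integrable fun x : Fin k → I => ∏ q ∈ E, w D q (x q.1) (x q.2) := fun D => by
    refine integrable_of_abs_le (Finset.measurable_prod _ fun q _ =>
      (hwm D q).comp (f := fun x : Fin k → I => (x q.1, x q.2)) (by fun_prop)) 1 fun x => ?_
    rw [abs_of_nonneg (Finset.prod_nonneg fun q _ => hw0 _ _ _ _)]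
    exact Finset.prod_le_one (fun q _ => hw0 _ _ _ _) fun q _ => hw1 _ _ _ _
  have step : ∀ D p, p ∉ D → p ∈ E → |t (insert p D) - t D| ≤ c := fun D p hpD hpE => by
    have hlt : p.1 < p.2 := (Finset.mem_filter.1 hpE).2
    let d : I → I → ℝ := fun x y => pairFactor F U p x y - pairFactor F W p x y
    have hd : cutNorm d = c := by
      by_cases h : F.Adj p.1 p.2
      · simp [d, pairFactor, h, c]
      · rw [← cutNorm_neg]
        simp only [d, pairFactor, h, c, if_false]
        congr! 3
        ring
    have h1 : t (insert p D) - t D = ∫ x : Fin k → I, d (x p.1) (x p.2) *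
        ∏ q ∈ E.erase p, w D q (x q.1) (x q.2) := by
      simp only [t]
      rw [← integral_sub (hti _) (hti _)]
      congr 1
      ext x
      rw [← Finset.mul_prod_erase E _ hpE, ← Finset.mul_prod_erase E _ hpE]
      have : ∏ q ∈ E.erase p, w (insert p D) q (x q.1) (x q.2) =
          ∏ q ∈ E.erase p, w D q (x q.1) (x q.2) :=
        Finset.prod_congr rfl fun q hq => by
          simp [w, Finset.mem_insert, Finset.ne_of_mem_erase hq]
      rw [this, ← sub_mul]
      simp [w, d, hpD]
    rw [h1, ← hd]
    refine abs_integral_mul_prod_le_cutNorm hlt.ne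
      ((measurable_pairFactor F U p).sub (measurable_pairFactor F W p)) (C := 1) (fun x y => ?_)
      (E.erase p) (fun q hq => ⟨Finset.ne_of_mem_erase hq, ?_⟩) (w D) (hwm D) (hw0 D) (hw1 D)
    · have := pairFactor_nonneg F U p x y
      have := pairFactor_nonneg F W p x y
      have := pairFactor_le_one F U p x y
      have := pairFactor_le_one F W p x y
      rw [abs_le]
      constructor <;> simp only [d] <;> linarith
    · rintro rfl
      exact absurd (Finset.mem_filter.1 (Finset.mem_of_mem_erase hq)).2 hlt.asymm
  have htel : ∀ D ⊆ E, |t D - t ∅| ≤ D.card * c := fun D => by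
    induction D using Finset.induction_on with
    | empty => simp
    | insert p D hp ih =>
      intro hD
      have h1 := ih ((Finset.subset_insert p D).trans hD)
      have h2 := step D p hp (hD (Finset.mem_insert_self p D))
      rw [Finset.card_insert_of_notMem hp]
      push_cast
      calc |t (insert p D) - t ∅| ≤ |t (insert p D) - t D| + |t D - t ∅| := abs_sub_le _ _ _
        _ ≤ _ := by linarith
  have hU : tInd F U = t E := by
    rw [tInd_eq_integral_prod]
    exact integral_congr_ae (Eventually.of_forall fun x =>
      Finset.prod_congr rfl fun q hq => by simp [w, E, (Finset.mem_filter.1 hq).2])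
  have hW : tInd F W = t ∅ := by
    rw [tInd_eq_integral_prod]
    simp [t, w, E]
  rw [hU, hW]
  refine (htel E subset_rfl).trans (mul_le_mul_of_nonneg_right ?_ (cutNorm_nonneg _))
  calc (E.card : ℝ) ≤ (Finset.univ : Finset (Fin k × Fin k)).card := by
        exact_mod_cast Finset.card_le_card (Finset.filter_subset _ _)
    _ = k ^ 2 := by simp [sq]

/-- The function `W^φ`. -/
def GraphFun.pullback (W : GraphFun) (φ : I ≃ᵐ I) : GraphFun where
  toFun x y := W.toFun (φ x) (φ y)
  measurable := W.measurable.comp (f := fun p : I × I => (φ p.1, φ p.2)) (by fun_prop)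
  symm _ _ := W.symm _ _
  nonneg _ _ := W.nonneg _ _
  le_one _ _ := W.le_one _ _

theorem tInd_pullback {k : ℕ} (F : SimpleGraph (Fin k)) (W : GraphFun) (φ : I ≃ᵐ I)
    (hφ : MeasurePreserving φ (volume : Measure I) (volume : Measure I)) :
    tInd F (W.pullback φ) = tInd F W := by
  rw [tInd_eq_integral_prod, tInd_eq_integral_prod]
  have := (volume_preserving_pi fun _ : Fin k => hφ).integral_comp'
    (f := MeasurableEquiv.piCongrRight fun _ => φ)
    (fun x => ∏ p : Fin k × Fin k with p.1 < p.2, pairFactor F W p (x p.1) (x p.2))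
  exact this

theorem abs_tInd_sub_tInd_le_cutDist {k : ℕ} (F : SimpleGraph (Fin k)) (U W : GraphFun) :
    |tInd F U - tInd F W| ≤ k ^ 2 * cutDist U W := by
  rcases k.eq_zero_or_pos with rfl | hk
  · simpa using abs_tInd_sub_tInd_le_cutNorm F U W
  have hk2 : (0 : ℝ) < k ^ 2 := by positivity
  rw [mul_comm, ← div_le_iff₀ hk2]
  refine le_csInf ⟨_, MeasurableEquiv.refl I, MeasurePreserving.id _, rfl⟩ ?_
  rintro r ⟨φ, hφ, rfl⟩
  rw [div_le_iff₀ hk2, mul_comm, ← tInd_pullback F W φ hφ]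
  exact abs_tInd_sub_tInd_le_cutNorm F U (W.pullback φ)

theorem cutDist_nonneg (U W : GraphFun) : 0 ≤ cutDist U W :=
  Real.sInf_nonneg fun _ ⟨_, _, h⟩ => h ▸ cutNorm_nonneg _

theorem cutDist_le_cutNorm (U W : GraphFun) :
    cutDist U W ≤ cutNorm fun x y => U.toFun x y - W.toFun x y :=
  csInf_le ⟨0, fun _ ⟨_, _, h⟩ => h ▸ cutNorm_nonneg _⟩
    ⟨MeasurableEquiv.refl I, MeasurePreserving.id _, rfl⟩

/-! ### The law of the random graph -/

theorem measurableSet_randomGraph_adj {k : ℕ} (W : GraphFun) (i j : Fin k) :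
    MeasurableSet {ω : SampleSpace k | (randomGraph k W ω).Adj i j} := by
  by_cases hij : i = j
  · subst hij; simp
  have : {ω : SampleSpace k | (randomGraph k W ω).Adj i j} =
      {ω | (ω.2 s(i, j) : ℝ) < W.toFun (ω.1 i) (ω.1 j)} := by
    ext ω; simp [randomGraph, hij]
  rw [this]
  exact measurableSet_lt (by fun_prop)
    (W.measurable.comp (f := fun ω : SampleSpace k => (ω.1 i, ω.1 j)) (by fun_prop))

theorem measurableSet_randomGraph_eq {k : ℕ} (W : GraphFun) (F : SimpleGraph (Fin k)) :
    MeasurableSet {ω : SampleSpace k | randomGraph k W ω = F} := by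
  have : {ω : SampleSpace k | randomGraph k W ω = F} =
      ⋂ (i) (j), {ω | (randomGraph k W ω).Adj i j ↔ F.Adj i j} := by
    ext ω
    simp only [Set.mem_iInter, Set.mem_ofPred_eq, SimpleGraph.ext_iff, funext_iff, eq_iff_iff]
  rw [this]
  exact .iInter fun i => .iInter fun j => (measurableSet_randomGraph_adj W i j).iff (.const _)

theorem measurableSet_randomGraph {k : ℕ} (W : GraphFun) (p : SimpleGraph (Fin k) → Prop) :
    MeasurableSet {ω : SampleSpace k | p (randomGraph k W ω)} := by
  have : {ω : SampleSpace k | p (randomGraph k W ω)} =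
      ⋃ (F : SimpleGraph (Fin k)) (_ : p F), {ω | randomGraph k W ω = F} := by
    ext ω
    simp
  rw [this]
  exact .iUnion fun F => .iUnion fun _ => measurableSet_randomGraph_eq W F

theorem measurable_comp_randomGraph {k : ℕ} (W : GraphFun) {α : Type*} [MeasurableSpace α]
    (f : SimpleGraph (Fin k) → α) : Measurable fun ω : SampleSpace k => f (randomGraph k W ω) :=
  fun s _ => measurableSet_randomGraph W fun G => f G ∈ s

/-- The sample space has a coordinate for every element of `Sym2`, loops included, while densities
are products over `i < j`. Loops impose no condition and contribute 1. -/
theorem prod_sym2_eq_prod_lt {k : ℕ} {M : Type*} [CommMonoid M] (f : Sym2 (Fin k) → M)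
    (hf : ∀ i, f s(i, i) = 1) :
    ∏ e, f e = ∏ p : Fin k × Fin k with p.1 < p.2, f s(p.1, p.2) := by
  classical
  have h1 : ∏ e : Sym2 (Fin k) with ¬ e.IsDiag, f e = ∏ e, f e := by
    refine Finset.prod_filter_of_ne fun e _ he hd => he ?_
    induction e with
    | _ a b =>
      obtain rfl : a = b := hd
      exact hf a
  rw [← h1]
  symm
  refine Finset.prod_bij (fun p _ => s(p.1, p.2)) (fun p hp => ?_) (fun p hp q hq h => ?_)
    (fun e he => ?_) fun _ _ => rfl
  · simpa using (Finset.mem_filter.1 hp).2.ne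
  · have h1 := (Finset.mem_filter.1 hp).2
    have h2 := (Finset.mem_filter.1 hq).2
    rcases Sym2.eq_iff.1 h with ⟨h3, h4⟩ | ⟨h3, h4⟩
    · exact Prod.ext h3 h4
    · rw [h3, h4] at h1
      exact absurd h1 h2.asymm
  · induction e with
    | _ a b =>
      have hab : a ≠ b := by simpa using he
      rcases hab.lt_or_gt with h | h
      · exact ⟨(a, b), by simpa using h, rfl⟩
      · exact ⟨(b, a), by simpa using h, Sym2.eq_swap⟩

theorem volume_coe_lt (a : ℝ) (h0 : 0 ≤ a) (h1 : a ≤ 1) :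
    volume {s : I | (s : ℝ) < a} = ENNReal.ofReal a :=
  unitInterval.volume_Iio (⟨a, h0, h1⟩ : I)

theorem volume_not_coe_lt (a : ℝ) (h0 : 0 ≤ a) (h1 : a ≤ 1) :
    volume {s : I | ¬ (s : ℝ) < a} = ENNReal.ofReal (1 - a) := by
  have : {s : I | ¬ (s : ℝ) < a} = Set.Ici (⟨a, h0, h1⟩ : I) := by
    ext s; simp [← Subtype.coe_le_coe]
  rw [this, unitInterval.volume_Ici]

/-- Once the points are fixed, the event is a box in the pair coordinates, of volume the product of
the pair factors; integrating over the points gives the density. -/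
theorem volume_randomGraph_eq {k : ℕ} (W : GraphFun) (F : SimpleGraph (Fin k)) :
    volume {ω : SampleSpace k | randomGraph k W ω = F} = ENNReal.ofReal (tInd F W) := by
  let f : (Fin k → I) → ℝ := fun x =>
    ∏ p : Fin k × Fin k with p.1 < p.2, pairFactor F W p (x p.1) (x p.2)
  have hf0 : ∀ x, 0 ≤ f x := fun x => Finset.prod_nonneg fun p _ => pairFactor_nonneg _ _ _ _ _
  have hfi : Integrable f volume := by
    refine integrable_of_abs_le (Finset.measurable_prod _ fun q _ =>
      (measurable_pairFactor F W q).comp (f := fun x : Fin k → I => (x q.1, x q.2))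
        (by fun_prop)) 1 fun x => ?_
    rw [abs_of_nonneg (hf0 x)]
    exact Finset.prod_le_one (fun _ _ => pairFactor_nonneg _ _ _ _ _)
      fun _ _ => pairFactor_le_one _ _ _ _ _
  have key : ∀ x : Fin k → I,
      volume (Prod.mk x ⁻¹' {ω : SampleSpace k | randomGraph k W ω = F}) =
        ENNReal.ofReal (f x) := fun x => by
    let B : Sym2 (Fin k) → Set I := fun e =>
      {s | ∀ i j, e = s(i, j) → i ≠ j → ((s : ℝ) < W.toFun (x i) (x j) ↔ F.Adj i j)}
    have h1 : Prod.mk x ⁻¹' {ω : SampleSpace k | randomGraph k W ω = F} = Set.univ.pi B := by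
      ext u
      simp only [Set.mem_preimage, Set.mem_ofPred_eq, SimpleGraph.ext_iff, funext_iff, eq_iff_iff,
        Set.mem_univ_pi, B]
      constructor
      · rintro h e i j rfl hij
        rw [← h i j]
        simp [randomGraph, hij]
      · intro h i j
        by_cases hij : i = j
        · subst hij; simp
        · rw [← h s(i, j) i j rfl hij]
          simp [randomGraph, hij]
    have h2 : ∀ i, volume (B s(i, i)) = 1 := fun i => by
      have : B s(i, i) = Set.univ := by
        refine Set.eq_univ_of_forall fun s a b hab hne => ?_
        rcases Sym2.eq_iff.1 hab with ⟨h3, h4⟩ | ⟨h3, h4⟩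
        · exact absurd (h3.symm.trans h4) hne
        · exact absurd (h4.symm.trans h3) hne
      rw [this, measure_univ]
    have h3 : ∀ p : Fin k × Fin k, p.1 < p.2 →
        volume (B s(p.1, p.2)) = ENNReal.ofReal (pairFactor F W p (x p.1) (x p.2)) := fun p hp => by
      have hB : B s(p.1, p.2) = {s : I | ((s : ℝ) < W.toFun (x p.1) (x p.2) ↔ F.Adj p.1 p.2)} := by
        ext s
        refine ⟨fun h => h p.1 p.2 rfl hp.ne, fun h a b hab hne => ?_⟩
        rcases Sym2.eq_iff.1 hab with ⟨h3, h4⟩ | ⟨h3, h4⟩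
        · rw [← h3, ← h4]; exact h
        · rw [← h3, ← h4, W.symm, F.adj_comm]; exact h
      rw [hB]
      by_cases h : F.Adj p.1 p.2
      · simpa only [h, iff_true, pairFactor, if_true] using
          volume_coe_lt _ (W.nonneg _ _) (W.le_one _ _)
      · simpa only [h, iff_false, pairFactor, if_false] using
          volume_not_coe_lt _ (W.nonneg _ _) (W.le_one _ _)
    rw [h1, volume_pi, Measure.pi_pi, prod_sym2_eq_prod_lt _ h2,
      ENNReal.ofReal_prod_of_nonneg fun _ _ => pairFactor_nonneg _ _ _ _ _]
    exact Finset.prod_congr rfl fun p hp => h3 p (Finset.mem_filter.1 hp).2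
  rw [tInd_eq_integral_prod]
  change (volume.prod volume) _ = _
  rw [Measure.prod_apply (measurableSet_randomGraph_eq W F)]
  simp_rw [key]
  rw [ofReal_integral_eq_lintegral_ofReal hfi (Eventually.of_forall hf0)]

theorem tInd_nonneg {k : ℕ} (F : SimpleGraph (Fin k)) (W : GraphFun) : 0 ≤ tInd F W := by
  rw [tInd_eq_integral_prod]
  exact integral_nonneg fun x => Finset.prod_nonneg fun _ _ => pairFactor_nonneg _ _ _ _ _

theorem volume_real_randomGraph_eq {k : ℕ} (W : GraphFun) (F : SimpleGraph (Fin k)) :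
    (volume : Measure (SampleSpace k)).real {ω | randomGraph k W ω = F} = tInd F W := by
  rw [measureReal_def, volume_randomGraph_eq, ENNReal.toReal_ofReal (tInd_nonneg F W)]

open Classical in
theorem volume_real_randomGraph {k : ℕ} (W : GraphFun) (p : SimpleGraph (Fin k) → Prop) :
    (volume : Measure (SampleSpace k)).real {ω | p (randomGraph k W ω)} =
      ∑ F : SimpleGraph (Fin k) with p F, tInd F W := by
  have : {ω : SampleSpace k | p (randomGraph k W ω)} =
      ⋃ F ∈ Finset.univ.filter p, {ω | randomGraph k W ω = F} := by
    ext ω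
    simp
  rw [this, measureReal_biUnion_finset _ fun F _ => measurableSet_randomGraph_eq W F]
  · exact Finset.sum_congr rfl fun F _ => volume_real_randomGraph_eq W F
  · intro F _ F' _ h
    exact Set.disjoint_left.2 fun ω h1 h2 => h (h1.symm.trans h2)

theorem randomGraph_null_iff_tInd_eq_zero (P : GraphProperty) (W : GraphFun) (k : ℕ) :
    (volume : Measure (SampleSpace k)) {ω | ¬ P.Holds (randomGraph k W ω)} = 0 ↔
      ∀ F : SimpleGraph (Fin k), ¬ P.Holds F → tInd F W = 0 := by
  classical
  rw [← measureReal_eq_zero_iff, volume_real_randomGraph W fun G => ¬ P.Holds G,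
    Finset.sum_eq_zero_iff_of_nonneg fun F _ => tInd_nonneg F W]
  simp

/-- The law of the random graph is Lipschitz with respect to the cut distance. -/
theorem abs_volume_real_randomGraph_sub_le (k : ℕ) : ∃ C : ℝ, 0 < C ∧
    ∀ (U W : GraphFun) (p : SimpleGraph (Fin k) → Prop),
      |(volume : Measure (SampleSpace k)).real {ω | p (randomGraph k U ω)} -
        (volume : Measure (SampleSpace k)).real {ω | p (randomGraph k W ω)}| ≤
        C * cutDist U W := by
  classical
  -- The summand 1 only keeps the constant positive, so that one can later divide by it.
  refine ⟨Fintype.card (SimpleGraph (Fin k)) * k ^ 2 + 1, by positivity, fun U W p => ?_⟩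
  rw [volume_real_randomGraph, volume_real_randomGraph, ← Finset.sum_sub_distrib]
  calc _ ≤ ∑ F : SimpleGraph (Fin k) with p F, |tInd F U - tInd F W| :=
        Finset.abs_sum_le_sum_abs _ _
    _ ≤ ∑ F : SimpleGraph (Fin k), |tInd F U - tInd F W| :=
        Finset.sum_le_sum_of_subset_of_nonneg (Finset.filter_subset _ _) fun _ _ _ => abs_nonneg _
    _ ≤ ∑ F : SimpleGraph (Fin k), k ^ 2 * cutDist U W :=
        Finset.sum_le_sum fun F _ => abs_tInd_sub_tInd_le_cutDist F U W
    _ ≤ _ := by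
        have := cutDist_nonneg U W
        simp only [Finset.sum_const, Finset.card_univ, nsmul_eq_mul]
        nlinarith

/-! ### The partition of the unit interval into cells of equal length -/

/-- The index of the interval `(i/n, (i+1)/n]` that contains `x`. -/
def cell (n : ℕ) [NeZero n] (x : I) : Fin n :=
  ⟨⌈(n : ℝ) * x⌉₊ - 1, by
    have h : ⌈(n : ℝ) * x⌉₊ ≤ n :=
      Nat.ceil_le.2 (mul_le_of_le_one_right (Nat.cast_nonneg n) x.2.2)
    have := NeZero.pos n
    omega⟩

/-- The point 0 lies in none of the half-open intervals, yet truncated subtraction assigns it index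
0. This null point is why later identities hold almost everywhere. -/
theorem cell_eq_iff {n : ℕ} [NeZero n] {x : I} (hx : x ≠ 0) (i : Fin n) :
    cell n x = i ↔ (x : ℝ) ∈ Set.Ioc ((i : ℝ) / n) (((i : ℝ) + 1) / n) := by
  have hn : (0 : ℝ) < n := by exact_mod_cast NeZero.pos n
  have hx0 : (0 : ℝ) < x := unitInterval.pos_iff_ne_zero.2 hx
  have hc : 0 < ⌈(n : ℝ) * x⌉₊ := Nat.ceil_pos.2 (by positivity)
  rw [Fin.ext_iff, Set.mem_Ioc, div_lt_iff₀ hn, le_div_iff₀ hn, mul_comm (x : ℝ)]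
  change ⌈(n : ℝ) * x⌉₊ - 1 = (i : ℕ) ↔ _
  rw [show ⌈(n : ℝ) * x⌉₊ - 1 = (i : ℕ) ↔ ⌈(n : ℝ) * x⌉₊ = (i : ℕ) + 1 by omega,
    Nat.ceil_eq_iff (by omega)]
  push_cast
  simp

theorem measurable_cell (n : ℕ) [NeZero n] : Measurable (cell n) := by
  refine measurable_to_countable' fun i => ?_
  have h : cell n ⁻¹' {i} = {x : I | ⌈(n : ℝ) * x⌉₊ - 1 = i} := by
    ext x; simp [cell, Fin.ext_iff]
  rw [h]
  have : Measurable fun x : I => ⌈(n : ℝ) * x⌉₊ - 1 :=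
    (measurable_of_countable fun m : ℕ => m - 1).comp (Nat.measurable_ceil.comp (by fun_prop))
  exact this (measurableSet_singleton _)

theorem volume_cell_preimage (n : ℕ) [NeZero n] (i : Fin n) :
    volume (cell n ⁻¹' {i}) = ENNReal.ofReal (1 / n) := by
  have hn : (0 : ℝ) < n := by exact_mod_cast NeZero.pos n
  have hi : (i : ℝ) + 1 ≤ n := by exact_mod_cast i.2
  let a : I := ⟨(i : ℝ) / n, by positivity, (div_le_one hn).2 (by linarith)⟩
  let b : I := ⟨((i : ℝ) + 1) / n, by positivity, (div_le_one hn).2 hi⟩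
  have h0 : ∀ᵐ x : I, x ≠ 0 := Measure.ae_ne volume 0
  have : (cell n ⁻¹' {i} : Set I) =ᵐ[volume] Set.Ioc a b := by
    filter_upwards [h0] with x hx
    exact propext (cell_eq_iff hx i)
  rw [measure_congr this, unitInterval.volume_Ioc]
  congr 1
  simp only [a, b]
  ring

theorem ofGraph_apply {n : ℕ} [NeZero n] (G : SimpleGraph (Fin n)) {x y : I} (hx : x ≠ 0)
    (hy : y ≠ 0) : (ofGraph G).toFun x y =
      open Classical in if G.Adj (cell n x) (cell n y) then 1 else 0 := by
  classical
  refine if_congr ⟨?_, fun h => ?_⟩ rfl rfl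
  · rintro ⟨i, j, h, hi, hj⟩
    rwa [(cell_eq_iff hx i).2 hi, (cell_eq_iff hy j).2 hj]
  · exact ⟨_, _, h, (cell_eq_iff hx _).1 rfl, (cell_eq_iff hy _).1 rfl⟩

theorem volume_real_cell_comp_eq {k n : ℕ} [NeZero n] (c : Fin k → Fin n) :
    (volume : Measure (Fin k → I)).real {x | cell n ∘ x = c} = 1 / (n : ℝ) ^ k := by
  have : {x : Fin k → I | cell n ∘ x = c} = Set.univ.pi fun i => cell n ⁻¹' {c i} := by
    ext x; simp [funext_iff]
  rw [measureReal_def, this, volume_pi, Measure.pi_pi]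
  simp only [volume_cell_preimage, Finset.prod_const, Finset.card_univ, Fintype.card_fin]
  rw [ENNReal.toReal_pow, ENNReal.toReal_ofReal (by positivity), one_div, inv_pow, one_div]

theorem ae_forall_ne {ι : Type*} [Fintype ι] (a : I) :
    ∀ᵐ x : ι → I, ∀ i, x i ≠ a := by
  rw [ae_all_iff]
  exact fun i => (measurePreserving_eval (fun _ : ι => (volume : Measure I))
    i).quasiMeasurePreserving.tendsto_ae.eventually (Measure.ae_ne (volume : Measure I) a)

/-- The edge probabilities are 0 or 1, so the pair coordinates matter only at the null value 1. What
remains is sampling nodes of `G` with replacement. -/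
theorem randomGraph_ofGraph_ae {k n : ℕ} [NeZero n] (G : SimpleGraph (Fin n)) :
    ∀ᵐ ω : SampleSpace k, randomGraph k (ofGraph G) ω = G.comap (cell n ∘ ω.1) := by
  have h1 : ∀ᵐ ω : SampleSpace k, ∀ i, ω.1 i ≠ 0 :=
    Measure.quasiMeasurePreserving_fst.tendsto_ae.eventually (ae_forall_ne 0)
  have h2 : ∀ᵐ ω : SampleSpace k, ∀ i, ω.2 i ≠ 1 :=
    Measure.quasiMeasurePreserving_snd.tendsto_ae.eventually (ae_forall_ne 1)
  filter_upwards [h1, h2] with ω h1 h2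
  ext i j
  have h3 : (ω.2 s(i, j) : ℝ) < 1 := unitInterval.lt_one_iff_ne_one.2 (h2 _)
  have h4 : (0 : ℝ) ≤ ω.2 s(i, j) := (ω.2 s(i, j)).2.1
  simp only [randomGraph, ofGraph_apply G (h1 i) (h1 j), SimpleGraph.comap_adj, Function.comp_apply]
  split_ifs with h
  · exact ⟨fun _ => h, fun _ => ⟨by rintro rfl; exact h.ne rfl, h3⟩⟩
  · exact ⟨fun h' => absurd h'.2 h4.not_gt, fun h' => absurd h' h⟩

open Classical in
theorem volume_real_randomGraph_ofGraph {k n : ℕ} [NeZero n] (G : SimpleGraph (Fin n))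
    (p : SimpleGraph (Fin k) → Prop) :
    (volume : Measure (SampleSpace k)).real {ω | p (randomGraph k (ofGraph G) ω)} =
      (Finset.univ.filter fun c : Fin k → Fin n => p (G.comap c)).card / (n : ℝ) ^ k := by
  have h1 : ({ω | p (randomGraph k (ofGraph G) ω)} : Set (SampleSpace k)) =ᵐ[volume]
      ({x | p (G.comap (cell n ∘ x))} : Set (Fin k → I)) ×ˢ Set.univ := by
    filter_upwards [randomGraph_ofGraph_ae G] with ω hω
    apply propext
    change p _ ↔ p _ ∧ True
    rw [hω, and_true]
  have h2 : {x : Fin k → I | p (G.comap (cell n ∘ x))} =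
      ⋃ c ∈ Finset.univ.filter fun c : Fin k → Fin n => p (G.comap c), {x | cell n ∘ x = c} := by
    ext x
    simp
  have hm : ∀ c : Fin k → Fin n, MeasurableSet {x : Fin k → I | cell n ∘ x = c} := fun c => by
    have : Measurable fun x : Fin k → I => cell n ∘ x :=
      measurable_pi_iff.2 fun i => (measurable_cell n).comp (measurable_pi_apply i)
    exact this (measurableSet_singleton c)
  rw [measureReal_congr h1]
  change (volume.prod volume).real _ = _
  rw [measureReal_prod_prod, probReal_univ, mul_one, h2, measureReal_biUnion_finset _ fun c _ => hm c]
  · simp only [volume_real_cell_comp_eq, Finset.sum_const, nsmul_eq_mul]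
    ring
  · intro c _ c' _ h
    exact Set.disjoint_left.2 fun ω h1 h2 => h (h1.symm.trans h2)

/-! ### Induced subgraphs and injective samples -/

open Classical in
theorem card_injective_range_eq {V : Type*} [Fintype V] (k : ℕ) (S : Set V) (hS : S.ncard = k) :
    (Finset.univ.filter fun c : Fin k → V => Function.Injective c ∧ Set.range c = S).card =
      k.factorial := by
  have e : {c : Fin k → V // Function.Injective c ∧ Set.range c = S} ≃ (Fin k ≃ S) :=
    { toFun := fun c => (Equiv.ofInjective c.1 c.2.1).trans (Equiv.setCongr c.2.2)
      invFun := fun e => ⟨fun i => e i, Subtype.val_injective.comp e.injective, by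
        ext v
        exact ⟨fun ⟨i, hi⟩ => hi ▸ (e i).2, fun hv => ⟨e.symm ⟨v, hv⟩, by simp⟩⟩⟩
      left_inv := fun c => rfl
      right_inv := fun e => by ext; rfl }
  have e' : Fin k ≃ S := Fintype.equivOfCardEq (by
    rw [Fintype.card_fin, ← hS, ← Nat.card_coe_set_eq, Nat.card_eq_fintype_card])
  rw [← Fintype.card_subtype, Fintype.card_congr e, Fintype.card_equiv e', Fintype.card_fin]

open Classical in
theorem card_injective_range {V : Type*} [Fintype V] (k : ℕ) (Q : Set V → Prop) :
    (Finset.univ.filter fun c : Fin k → V => Function.Injective c ∧ Q (Set.range c)).card =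
      k.factorial * {S : Set V | S.ncard = k ∧ Q S}.ncard := by
  have hrange : ∀ c : Fin k → V, Function.Injective c → (Set.range c).ncard = k := fun c hc => by
    rw [← Nat.card_coe_set_eq, Nat.card_range_of_injective hc, Nat.card_fin]
  rw [Set.ncard_eq_toFinset_card', mul_comm, ← smul_eq_mul, ← Finset.sum_const,
    Finset.card_eq_sum_card_fiberwise (f := Set.range)
      (t := {S : Set V | S.ncard = k ∧ Q S}.toFinset)]
  · refine Finset.sum_congr rfl fun S hS => ?_
    obtain ⟨h1, h2⟩ : S.ncard = k ∧ Q S := by simpa using hS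
    rw [← card_injective_range_eq k S h1, Finset.filter_filter]
    congr 1
    ext c
    simp only [Finset.mem_filter, Finset.mem_univ, true_and]
    exact ⟨fun h => ⟨h.1.1, h.2⟩, fun h => ⟨⟨h.1, h.2 ▸ h2⟩, h.2⟩⟩
  · intro c hc
    simp only [Finset.coe_filter, Finset.mem_univ, true_and, Set.mem_ofPred_eq] at hc
    simpa using ⟨hrange c hc.1, hc.2⟩

theorem GraphProperty.holds_congr (P : GraphProperty) {V V' : Type} [Finite V] [Finite V']
    {G : SimpleGraph V} {G' : SimpleGraph V'} (e : G ≃g G') : P.Holds G ↔ P.Holds G' :=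
  ⟨P.iso_invariant ⟨e⟩, P.iso_invariant ⟨e.symm⟩⟩

theorem GraphProperty.holds_comap_iff_holds_induce (P : GraphProperty) {V V' : Type} [Finite V]
    [Finite V'] (G : SimpleGraph V) {c : V' → V} (hc : Function.Injective c) :
    P.Holds (G.comap c) ↔ P.Holds (G.induce (Set.range c)) :=
  P.holds_congr { toEquiv := Equiv.ofInjective c hc, map_rel_iff' := Iff.rfl }

open Classical in
-- Every `k`-set is the range of exactly `k!` injections, and this factor cancels. Counting maps
-- makes the fraction comparable with sampling with replacement.
theorem inducedFraction_eq {n : ℕ} (k : ℕ) (G : SimpleGraph (Fin n)) (P : GraphProperty) :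
    inducedFraction k G P =
      ((Finset.univ.filter fun c : Fin k → Fin n =>
        Function.Injective c ∧ P.Holds (G.comap c)).card : ℝ) / n.descFactorial k := by
  have h1 : (Finset.univ.filter fun c : Fin k → Fin n =>
      Function.Injective c ∧ P.Holds (G.comap c)).card =
      k.factorial * {S : Set (Fin n) | S.ncard = k ∧ P.Holds (G.induce S)}.ncard := by
    rw [← card_injective_range k fun S => P.Holds (G.induce S)]
    congr 1
    ext c
    simp only [Finset.mem_filter, Finset.mem_univ, true_and]
    exact and_congr_right fun hc => P.holds_comap_iff_holds_induce G hc
  have h2 : n.descFactorial k = k.factorial * {S : Set (Fin n) | S.ncard = k}.ncard := by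
    have := card_injective_range (V := Fin n) k fun _ => True
    simp only [and_true] at this
    rw [← this, ← Fintype.card_subtype, Fintype.card_congr (Equiv.subtypeInjectiveEquivEmbedding _ _),
      Fintype.card_embedding_eq, Fintype.card_fin, Fintype.card_fin]
  rw [h1, h2, inducedFraction]
  push_cast
  rw [mul_div_mul_left _ _ (by exact_mod_cast k.factorial_ne_zero)]

open Classical in
-- The birthday bound. For `k ≤ n` it follows from Bernoulli's inequality applied to `(1 - k/n) ^
-- k`; for `k > n` the right side exceeds 1.
theorem card_not_injective_le {k n : ℕ} (hn : 0 < n) :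
    ((Finset.univ.filter fun c : Fin k → Fin n => ¬ Function.Injective c).card : ℝ) / (n : ℝ) ^ k ≤
      k ^ 2 / n := by
  have hn' : (0 : ℝ) < n := by exact_mod_cast hn
  have hinj : (Finset.univ.filter fun c : Fin k → Fin n => Function.Injective c).card =
      n.descFactorial k := by
    rw [← Fintype.card_subtype, Fintype.card_congr (Equiv.subtypeInjectiveEquivEmbedding _ _),
      Fintype.card_embedding_eq, Fintype.card_fin, Fintype.card_fin]
  have hadd := Finset.card_filter_add_card_filter_not (s := (Finset.univ : Finset (Fin k → Fin n)))
    fun c : Fin k → Fin n => Function.Injective c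
  rw [hinj, Finset.card_univ, Fintype.card_fun, Fintype.card_fin, Fintype.card_fin] at hadd
  have hcard : ((Finset.univ.filter fun c : Fin k → Fin n => ¬ Function.Injective c).card : ℝ) =
      (n : ℝ) ^ k - n.descFactorial k := by
    rw [eq_sub_iff_add_eq, add_comm]
    exact_mod_cast hadd
  have hnk : (0 : ℝ) < (n : ℝ) ^ k := by positivity
  rcases le_or_gt k n with hk | hk
  · have h1 : ((n : ℝ) + 1 - k) ^ k ≤ n.descFactorial k := by
      have := Nat.pow_sub_le_descFactorial n k
      have h : (((n + 1 - k : ℕ) : ℝ)) ^ k ≤ n.descFactorial k := by exact_mod_cast this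
      rwa [Nat.cast_sub (by omega), Nat.cast_add, Nat.cast_one] at h
    have hkn : (k : ℝ) ≤ n := by exact_mod_cast hk
    have hdiv : (k : ℝ) / n ≤ 1 := (div_le_one hn').2 hkn
    have hdiv0 : (0 : ℝ) ≤ k / n := by positivity
    have h2 := one_add_mul_le_pow (a := -((k : ℝ) / n)) (by linarith) k
    have h3 : (1 + -((k : ℝ) / n)) ^ k * (n : ℝ) ^ k ≤ n.descFactorial k := by
      rw [← mul_pow]
      refine le_trans (pow_le_pow_left₀ (by
        rw [add_mul, neg_mul, div_mul_cancel₀ _ hn'.ne']; linarith) ?_ k) h1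
      rw [add_mul, neg_mul, div_mul_cancel₀ _ hn'.ne']; linarith
    rw [hcard, div_le_iff₀ hnk]
    have h4 : (k : ℝ) ^ 2 / n = k * (k / n) := by ring
    rw [h4]
    nlinarith [mul_le_mul_of_nonneg_right h2 hnk.le]
  · have hkn : (n : ℝ) < k := by exact_mod_cast hk
    have hdf : (0 : ℝ) ≤ n.descFactorial k := Nat.cast_nonneg _
    have hn1 : (1 : ℝ) ≤ n := by exact_mod_cast hn
    calc _ ≤ (1 : ℝ) := by rw [hcard, div_le_one hnk]; linarith
      _ ≤ _ := by rw [le_div_iff₀ hn']; nlinarith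

theorem inducedFraction_nonneg {V : Type} [Finite V] (k : ℕ) (G : SimpleGraph V)
    (P : GraphProperty) : 0 ≤ inducedFraction k G P := by
  unfold inducedFraction; positivity

theorem inducedFraction_le_one {V : Type} [Finite V] (k : ℕ) (G : SimpleGraph V)
    (P : GraphProperty) : inducedFraction k G P ≤ 1 := by
  refine div_le_one_of_le₀ ?_ (Nat.cast_nonneg _)
  have : {S : Set V | S.ncard = k ∧ P.Holds (G.induce S)} ⊆ {S : Set V | S.ncard = k} :=
    fun S hS => hS.1
  exact_mod_cast Set.ncard_le_ncard this (Set.toFinite _)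

open Classical in
theorem inducedFraction_comap {n : ℕ} (k : ℕ) (G : SimpleGraph (Fin n)) (P : GraphProperty)
    (π : Equiv.Perm (Fin n)) : inducedFraction k (G.comap π) P = inducedFraction k G P := by
  rw [inducedFraction_eq, inducedFraction_eq]
  congr 2
  refine Finset.card_equiv (Equiv.arrowCongr (Equiv.refl _) π) fun c => ?_
  simp only [Finset.mem_filter, Finset.mem_univ, true_and]
  refine and_congr ?_ (by rw [SimpleGraph.comap_comap]; rfl)
  exact (π.injective.of_comp_iff c).symm

/-- Sampling from a graph with and without replacement. -/
theorem abs_volume_real_randomGraph_ofGraph_sub_inducedFraction_le {k n : ℕ} [NeZero n]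
    (hkn : k ≤ n) (G : SimpleGraph (Fin n)) (P : GraphProperty) :
    |(volume : Measure (SampleSpace k)).real {ω | P.Holds (randomGraph k (ofGraph G) ω)} -
      inducedFraction k G P| ≤ k ^ 2 / n := by
  classical
  have hn' : (0 : ℝ) < n := by exact_mod_cast NeZero.pos n
  have hnk : (0 : ℝ) < (n : ℝ) ^ k := by positivity
  have hf0 := inducedFraction_nonneg k G P
  have hf1 := inducedFraction_le_one k G P
  have hni := card_not_injective_le (k := k) (NeZero.pos n)
  rw [volume_real_randomGraph_ofGraph G fun H => P.Holds H]
  rw [inducedFraction_eq] at *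
  have hinj : (Finset.univ.filter fun c : Fin k → Fin n => Function.Injective c).card =
      n.descFactorial k := by
    rw [← Fintype.card_subtype, Fintype.card_congr (Equiv.subtypeInjectiveEquivEmbedding _ _),
      Fintype.card_embedding_eq, Fintype.card_fin, Fintype.card_fin]
  have hadd := Finset.card_filter_add_card_filter_not (s := (Finset.univ : Finset (Fin k → Fin n)))
    fun c : Fin k → Fin n => Function.Injective c
  rw [hinj, Finset.card_univ, Fintype.card_fun, Fintype.card_fin, Fintype.card_fin] at hadd
  have hadd' := Finset.card_filter_add_card_filter_not
    (s := Finset.univ.filter fun c : Fin k → Fin n => P.Holds (G.comap c))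
    fun c : Fin k → Fin n => Function.Injective c
  have hle : ((Finset.univ.filter fun c : Fin k → Fin n => P.Holds (G.comap c)).filter
      fun c => ¬ Function.Injective c).card ≤
      (Finset.univ.filter fun c : Fin k → Fin n => ¬ Function.Injective c).card :=
    Finset.card_le_card (Finset.filter_subset_filter _ (Finset.filter_subset _ _))
  rw [Finset.filter_filter, Finset.filter_congr fun c _ => and_comm] at hadd'
  set a := (Finset.univ.filter fun c : Fin k → Fin n =>
    Function.Injective c ∧ P.Holds (G.comap c)).card
  set b := (Finset.univ.filter fun c : Fin k → Fin n => P.Holds (G.comap c)).card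
  set d := ((Finset.univ.filter fun c : Fin k → Fin n => P.Holds (G.comap c)).filter
      fun c => ¬ Function.Injective c).card
  set e := (Finset.univ.filter fun c : Fin k → Fin n => ¬ Function.Injective c).card
  have hD : (0 : ℝ) < n.descFactorial k := by
    exact_mod_cast Nat.descFactorial_pos.2 hkn
  set f := (a : ℝ) / n.descFactorial k with hf
  have ha : (a : ℝ) = f * n.descFactorial k := by rw [hf]; field_simp
  have hb : (b : ℝ) = a + d := by exact_mod_cast hadd'.symm
  have hN : (n : ℝ) ^ k = n.descFactorial k + e := by exact_mod_cast hadd.symm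
  have hde : (d : ℝ) ≤ e := by exact_mod_cast hle
  have hd0 : (0 : ℝ) ≤ d := Nat.cast_nonneg d
  have he0 : (0 : ℝ) ≤ e := Nat.cast_nonneg e
  refine le_trans ?_ hni
  -- Both `d` and `f * e` lie between 0 and `e`, so the discrepancy is at most the probability of a
  -- collision.
  have : (b : ℝ) / (n : ℝ) ^ k - f = (d - f * e) / (n : ℝ) ^ k := by
    rw [eq_div_iff hnk.ne', sub_mul, div_mul_cancel₀ _ hnk.ne', hb, ha, hN]; ring
  rw [this, abs_div, abs_of_pos hnk]
  refine div_le_div_of_nonneg_right (abs_le.2 ⟨?_, ?_⟩) hnk.le <;> nlinarith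

/-! ### Step functions on the cells -/

/-- Two applications of Cauchy-Schwarz, eliminating first `s` and then `t`, bound a bilinear form by
the 4-cycle sum of `X`. The weights stand for the measures of `S` and `T` inside the cells, hence
the size `1/k`. -/
theorem sum_mul_pow_four_le {k : ℕ} (X : Fin k → Fin k → ℝ) (s t : Fin k → ℝ)
    (hs : ∀ i, s i ^ 2 ≤ (1 / (k : ℝ)) ^ 2) (ht : ∀ i, t i ^ 2 ≤ (1 / (k : ℝ)) ^ 2) :
    (∑ i, s i * ∑ j, X i j * t j) ^ 4 ≤
      (∑ q : Fin k × Fin k, (∑ i, X i q.1 * X i q.2) ^ 2) / (k : ℝ) ^ 4 := by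
  rcases k.eq_zero_or_pos with rfl | hk
  · simp
  have hk' : (0 : ℝ) < k := by exact_mod_cast hk
  have h1 := Finset.sum_mul_sq_le_sq_mul_sq Finset.univ s fun i => ∑ j, X i j * t j
  have h2 : ∑ i, (∑ j, X i j * t j) ^ 2 =
      ∑ q : Fin k × Fin k, (t q.1 * t q.2) * ∑ i, X i q.1 * X i q.2 := by
    simp_rw [sq, Finset.sum_mul_sum, Finset.mul_sum, Fintype.sum_prod_type]
    rw [Finset.sum_comm]
    refine Finset.sum_congr rfl fun j _ => ?_
    rw [Finset.sum_comm]
    exact Finset.sum_congr rfl fun j' _ => Finset.sum_congr rfl fun i _ => by ring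
  have h3 := Finset.sum_mul_sq_le_sq_mul_sq Finset.univ
    (fun q : Fin k × Fin k => t q.1 * t q.2) fun q => ∑ i, X i q.1 * X i q.2
  have hS : ∑ i, s i ^ 2 ≤ 1 / k := by
    refine (Finset.sum_le_sum fun i _ => hs i).trans_eq ?_
    simp only [Finset.sum_const, Finset.card_univ, Fintype.card_fin, nsmul_eq_mul]
    field_simp
  have hT : ∑ q : Fin k × Fin k, (t q.1 * t q.2) ^ 2 ≤ (1 / k) ^ 2 := by
    have : ∀ q : Fin k × Fin k, (t q.1 * t q.2) ^ 2 ≤ (1 / (k : ℝ)) ^ 2 * (1 / (k : ℝ)) ^ 2 :=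
      fun q => by
        rw [mul_pow]
        exact mul_le_mul (ht _) (ht _) (sq_nonneg _) (sq_nonneg _)
    refine (Finset.sum_le_sum fun q _ => this q).trans_eq ?_
    simp only [Finset.sum_const, Finset.card_univ, Fintype.card_prod, Fintype.card_fin,
      nsmul_eq_mul]
    push_cast
    field_simp
  set Y := ∑ q : Fin k × Fin k, (∑ i, X i q.1 * X i q.2) ^ 2
  set B := ∑ i, (∑ j, X i j * t j) ^ 2
  have hY : 0 ≤ Y := Finset.sum_nonneg fun _ _ => sq_nonneg _
  have hB : 0 ≤ B := Finset.sum_nonneg fun _ _ => sq_nonneg _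
  have hB2 : B ^ 2 ≤ (1 / k) ^ 2 * Y := by
    rw [h2]
    exact h3.trans (mul_le_mul_of_nonneg_right hT hY)
  have h4 : (∑ i, s i * ∑ j, X i j * t j) ^ 2 ≤ 1 / k * B :=
    h1.trans (mul_le_mul_of_nonneg_right hS hB)
  calc (∑ i, s i * ∑ j, X i j * t j) ^ 4 = ((∑ i, s i * ∑ j, X i j * t j) ^ 2) ^ 2 := by ring
    _ ≤ (1 / k * B) ^ 2 := pow_le_pow_left₀ (sq_nonneg _) h4 2
    _ = (1 / k) ^ 2 * B ^ 2 := by ring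
    _ ≤ (1 / k) ^ 2 * ((1 / k) ^ 2 * Y) := by gcongr
    _ = Y / (k : ℝ) ^ 4 := by field_simp

theorem setIntegral_cell {k : ℕ} [NeZero k] (A : Fin k → Fin k → ℝ) (S T : Set I) :
    ∫ p in S ×ˢ T, A (cell k p.1) (cell k p.2) =
      ∑ i, volume.real (cell k ⁻¹' {i} ∩ S) * ∑ j, A i j * volume.real (cell k ⁻¹' {j} ∩ T) := by
  have hm : ∀ i, MeasurableSet (cell k ⁻¹' {i}) := fun i =>
    measurable_cell k (measurableSet_singleton i)
  have h1 : ∀ p : I × I, A (cell k p.1) (cell k p.2) =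
      ∑ i, ∑ j, A i j * ((cell k ⁻¹' {i}).indicator 1 p.1 * (cell k ⁻¹' {j}).indicator 1 p.2) := by
    intro p
    rw [Finset.sum_eq_single (cell k p.1), Finset.sum_eq_single (cell k p.2)]
    · simp
    · intro j _ hj
      simp [hj.symm]
    · simp
    · intro i _ hi
      simp [hi.symm]
    · simp
  have hi : ∀ i j, Integrable (fun p : I × I =>
      A i j * ((cell k ⁻¹' {i}).indicator 1 p.1 * (cell k ⁻¹' {j}).indicator (1 : I → ℝ) p.2))
      (volume.restrict (S ×ˢ T)) := fun i j => by
    refine Integrable.const_mul (integrable_of_abs_le ?_ 1 fun p => ?_) _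
    · exact ((measurable_one.indicator (hm i)).comp measurable_fst).mul
        ((measurable_one.indicator (hm j)).comp measurable_snd)
    · by_cases h1 : p.1 ∈ cell k ⁻¹' {i} <;> by_cases h2 : p.2 ∈ cell k ⁻¹' {j} <;>
        simp only [Set.indicator, h1, h2] <;> simp
  simp_rw [h1]
  rw [integral_finsetSum _ fun i _ => integrable_finsetSum _ fun j _ => hi i j]
  refine Finset.sum_congr rfl fun i _ => ?_
  rw [integral_finsetSum _ fun j _ => hi i j, Finset.mul_sum]
  refine Finset.sum_congr rfl fun j _ => ?_
  rw [integral_const_mul]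
  have h2 := setIntegral_prod_mul (μ := (volume : Measure I)) (ν := (volume : Measure I))
    ((cell k ⁻¹' {i}).indicator (1 : I → ℝ)) ((cell k ⁻¹' {j}).indicator (1 : I → ℝ)) S T
  rw [integral_indicator_one (hm i), integral_indicator_one (hm j),
    measureReal_restrict_apply (hm i), measureReal_restrict_apply (hm j)] at h2
  rw [show ∫ p in S ×ˢ T, (cell k ⁻¹' {i}).indicator 1 p.1 *
    (cell k ⁻¹' {j}).indicator (1 : I → ℝ) p.2 = _ from h2]
  ring

theorem abs_setIntegral_cell_le {k : ℕ} [NeZero k] (X : Fin k → Fin k → ℝ)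
    {η : ℝ} (hη : 0 ≤ η)
    (hX : ∑ q : Fin k × Fin k, (∑ i, X i q.1 * X i q.2) ^ 2 ≤ η ^ 4 * (k : ℝ) ^ 4)
    (S T : Set I) :
    |∫ p in S ×ˢ T, X (cell k p.1) (cell k p.2)| ≤ η := by
  have hk' : (0 : ℝ) < k := by exact_mod_cast NeZero.pos k
  have hs : ∀ (S : Set I) i, volume.real (cell k ⁻¹' {i} ∩ S) ^ 2 ≤ (1 / (k : ℝ)) ^ 2 := by
    intro S i
    refine pow_le_pow_left₀ measureReal_nonneg ?_ 2
    refine (measureReal_mono Set.inter_subset_left).trans_eq ?_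
    rw [measureReal_def, volume_cell_preimage, ENNReal.toReal_ofReal (by positivity)]
  rw [setIntegral_cell X S T]
  have h := sum_mul_pow_four_le X _ _ (hs S) (hs T)
  have h' := h.trans ((div_le_iff₀ (by positivity)).2 hX)
  rw [← Even.pow_abs (by decide)] at h'
  exact le_of_pow_le_pow_left₀ (by norm_num) hη h'

/-! ### The noise of the random graph -/

/-- The difference of the adjacency indicator of the random graph and the edge probability. -/
def edgeNoise {k : ℕ} (W : GraphFun) (ω : SampleSpace k) (i j : Fin k) : ℝ :=
  open Classical in if i = j then 0 else
    (if (ω.2 s(i, j) : ℝ) < W.toFun (ω.1 i) (ω.1 j) then 1 else 0) - W.toFun (ω.1 i) (ω.1 j)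

theorem measurable_edgeNoise {k : ℕ} (W : GraphFun) (i j : Fin k) :
    Measurable fun ω : SampleSpace k => edgeNoise W ω i j := by
  unfold edgeNoise
  by_cases hij : i = j
  · simp only [hij, if_true, measurable_const]
  · simp only [hij, if_false]
    have hW : Measurable fun ω : SampleSpace k => W.toFun (ω.1 i) (ω.1 j) :=
      W.measurable.comp (f := fun ω : SampleSpace k => (ω.1 i, ω.1 j)) (by fun_prop)
    exact (Measurable.ite (measurableSet_lt (by fun_prop) hW) measurable_const
      measurable_const).sub hW

theorem abs_edgeNoise_le_one {k : ℕ} (W : GraphFun) (ω : SampleSpace k) (i j : Fin k) :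
    |edgeNoise W ω i j| ≤ 1 := by
  have h0 := W.nonneg (ω.1 i) (ω.1 j)
  have h1 := W.le_one (ω.1 i) (ω.1 j)
  unfold edgeNoise
  rw [abs_le]
  split_ifs <;> constructor <;> linarith

theorem integral_indicator_lt_sub (a : ℝ) (h0 : 0 ≤ a) (h1 : a ≤ 1) :
    ∫ s : I, ({s : I | (s : ℝ) < a}.indicator 1 s - a) = 0 := by
  have hm : MeasurableSet {s : I | (s : ℝ) < a} := measurableSet_lt (by fun_prop) measurable_const
  have hi : Integrable ({s : I | (s : ℝ) < a}.indicator (1 : I → ℝ)) volume :=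
    (integrable_indicator_iff hm).2 (integrable_const (1 : ℝ)).integrableOn
  rw [integral_sub hi (integrable_const a), integral_indicator_lt a h0 h1]
  simp

/-- If one of the four pairs is a loop, a factor vanishes. Otherwise the coordinate of the pair `ij`
enters only the factor `ij`, which has mean zero given the points; integrating that coordinate first
kills the product. -/
theorem integral_edgeNoise_four_eq_zero {k : ℕ} (W : GraphFun) {i i' j j' : Fin k} (hi : i ≠ i')
    (hj : j ≠ j') :
    ∫ ω : SampleSpace k, (edgeNoise W ω i j * edgeNoise W ω i j') *
      (edgeNoise W ω i' j * edgeNoise W ω i' j') = 0 := by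
  classical
  have hdiag : ∀ (ω : SampleSpace k) l, edgeNoise W ω l l = 0 := fun ω l => by simp [edgeNoise]
  by_cases h1 : i = j
  · subst h1; simp [hdiag]
  by_cases h2 : i = j'
  · subst h2; simp [hdiag]
  by_cases h3 : i' = j
  · subst h3; simp [hdiag]
  by_cases h4 : i' = j'
  · subst h4; simp [hdiag]
  let r : SampleSpace k → ℝ := fun ω =>
    edgeNoise W ω i j' * (edgeNoise W ω i' j * edgeNoise W ω i' j')
  let g : SampleSpace k → ℝ := fun ω => edgeNoise W ω i j * r ω
  have hg : ∀ ω : SampleSpace k, (edgeNoise W ω i j * edgeNoise W ω i j') *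
      (edgeNoise W ω i' j * edgeNoise W ω i' j') = g ω := fun ω => mul_assoc _ _ _
  have hgm : Measurable g := (measurable_edgeNoise W i j).mul ((measurable_edgeNoise W i j').mul
    ((measurable_edgeNoise W i' j).mul (measurable_edgeNoise W i' j')))
  have hg1 : ∀ ω, |g ω| ≤ 1 := fun ω => by
    simp only [g, r, abs_mul]
    exact mul_le_one₀ (abs_edgeNoise_le_one _ _ _ _) (by positivity)
      (mul_le_one₀ (abs_edgeNoise_le_one _ _ _ _) (by positivity)
        (mul_le_one₀ (abs_edgeNoise_le_one _ _ _ _) (abs_nonneg _) (abs_edgeNoise_le_one _ _ _ _)))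
  simp_rw [hg]
  change ∫ ω, g ω ∂((volume : Measure (Fin k → I)).prod (volume : Measure (Sym2 (Fin k) → I))) = 0
  rw [integral_prod _ (integrable_of_abs_le hgm 1 hg1)]
  refine integral_eq_zero_of_ae (Eventually.of_forall fun x => ?_)
  have hu := measurePreserving_update (volume : Measure I) s(i, j)
  have hgx : Measurable fun u => g (x, u) := hgm.comp (by fun_prop)
  have h5 := integral_map (μ := (Measure.pi fun _ => volume).prod volume) hu.measurable.aemeasurable (f := fun u => g (x, u))
    hgx.aestronglyMeasurable
  rw [hu.map_eq] at h5
  change ∫ u, g (x, u) ∂(Measure.pi fun _ => volume) = 0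
  have h6 := integral_prod (μ := Measure.pi fun _ => volume) (ν := volume) _
    (integrable_of_abs_le (hgx.comp hu.measurable) 1 fun z => hg1 _)
  refine h5.trans (h6.trans ?_)
  refine integral_eq_zero_of_ae (Eventually.of_forall fun u => ?_)
  have hne : ∀ a b, s(a, b) ≠ s(i, j) → ∀ s,
      edgeNoise W (x, Function.update u s(i, j) s) a b = edgeNoise W (x, u) a b :=
    fun a b hab s => by simp [edgeNoise, Function.update_of_ne hab]
  have e1 : s(i, j') ≠ s(i, j) := fun h => by
    rcases Sym2.eq_iff.1 h with ⟨-, h⟩ | ⟨h, -⟩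
    exacts [hj h.symm, h1 h]
  have e2 : s(i', j) ≠ s(i, j) := fun h => by
    rcases Sym2.eq_iff.1 h with ⟨h, -⟩ | ⟨h, -⟩
    exacts [hi h.symm, h3 h]
  have e3 : s(i', j') ≠ s(i, j) := fun h => by
    rcases Sym2.eq_iff.1 h with ⟨h, -⟩ | ⟨-, h⟩
    exacts [hi h.symm, h2 h.symm]
  have h7 : ∀ s, g (x, Function.update u s(i, j) s) =
      ({s : I | (s : ℝ) < W.toFun (x i) (x j)}.indicator 1 s - W.toFun (x i) (x j)) *
        r (x, u) := fun s => by
    simp only [g, r, hne _ _ e1, hne _ _ e2, hne _ _ e3]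
    congr 1
    simp [edgeNoise, h1, Set.indicator]
  simp only [Function.comp_apply, h7, Pi.zero_apply]
  rw [integral_mul_const, integral_indicator_lt_sub _ (W.nonneg _ _) (W.le_one _ _), zero_mul]

/-- After expanding the square, only quadruples with equal rows or equal columns survive: at most `2
* k ^ 3` terms, each at most 1. -/
theorem integral_sum_edgeNoise_le {k : ℕ} (W : GraphFun) :
    ∫ ω : SampleSpace k, ∑ q : Fin k × Fin k,
      (∑ i, edgeNoise W ω i q.1 * edgeNoise W ω i q.2) ^ 2 ≤ 2 * (k : ℝ) ^ 3 := by
  classical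
  let f : SampleSpace k → (Fin k × Fin k) × Fin k × Fin k → ℝ := fun ω z =>
    (edgeNoise W ω z.2.1 z.1.1 * edgeNoise W ω z.2.1 z.1.2) *
      (edgeNoise W ω z.2.2 z.1.1 * edgeNoise W ω z.2.2 z.1.2)
  have hf1 : ∀ ω z, |f ω z| ≤ 1 := fun ω z => by
    simp only [f, abs_mul]
    exact mul_le_one₀ (mul_le_one₀ (abs_edgeNoise_le_one _ _ _ _) (abs_nonneg _)
      (abs_edgeNoise_le_one _ _ _ _)) (by positivity) (mul_le_one₀ (abs_edgeNoise_le_one _ _ _ _)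
      (abs_nonneg _) (abs_edgeNoise_le_one _ _ _ _))
  have hfi : ∀ z, Integrable (fun ω => f ω z) := fun z =>
    integrable_of_abs_le (((measurable_edgeNoise W _ _).mul (measurable_edgeNoise W _ _)).mul
      ((measurable_edgeNoise W _ _).mul (measurable_edgeNoise W _ _))) 1 fun ω => hf1 ω z
  have hsum : ∀ ω : SampleSpace k, ∑ q : Fin k × Fin k,
      (∑ i, edgeNoise W ω i q.1 * edgeNoise W ω i q.2) ^ 2 = ∑ z, f ω z := fun ω => by
    rw [Fintype.sum_prod_type (f := f ω)]
    refine Finset.sum_congr rfl fun q _ => ?_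
    rw [sq, Finset.sum_mul_sum, Fintype.sum_prod_type]
  simp_rw [hsum]
  rw [integral_finsetSum _ fun z _ => hfi z]
  have hz : ∀ z : (Fin k × Fin k) × Fin k × Fin k, ∫ ω, f ω z ≤
      (if z.1.1 = z.1.2 then 1 else 0) + if z.2.1 = z.2.2 then 1 else 0 := fun z => by
    have hle : ∫ ω, f ω z ≤ 1 := (le_abs_self _).trans (abs_integral_le_of_abs_le fun ω => hf1 ω z)
    by_cases h1 : z.1.1 = z.1.2
    · by_cases h2 : z.2.1 = z.2.2 <;> simp only [h1, h2, if_true, if_false] <;> linarith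
    · by_cases h2 : z.2.1 = z.2.2
      · simp only [h1, h2, if_true, if_false]; linarith
      · simp only [h1, h2, if_false, add_zero]
        exact (integral_edgeNoise_four_eq_zero W h2 h1).le
  refine (Finset.sum_le_sum fun z _ => hz z).trans_eq ?_
  rw [Finset.sum_add_distrib]
  have h1 : ∑ q : Fin k × Fin k, (if q.1 = q.2 then (1 : ℝ) else 0) = k := by
    rw [Fintype.sum_prod_type]
    simp
  rw [Fintype.sum_prod_type' fun (q _ : Fin k × Fin k) => if q.1 = q.2 then (1 : ℝ) else 0,
    Fintype.sum_prod_type' fun (_ q : Fin k × Fin k) => if q.1 = q.2 then (1 : ℝ) else 0]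
  simp only [h1, Finset.sum_const, Finset.card_univ, Fintype.card_fin, Fintype.card_prod,
    nsmul_eq_mul, ← Finset.mul_sum]
  push_cast
  ring

/-! ### Independent uniform points -/

theorem measurePreserving_eval_pair {ι α : Type*} [Fintype ι] [MeasurableSpace α]
    (μ : Measure α) [IsProbabilityMeasure μ] {i j : ι} (hij : i ≠ j) :
    MeasurePreserving (fun x : ι → α => (x i, x j)) (Measure.pi fun _ => μ) (μ.prod μ) := by
  classical
  have hm : Measurable fun x : ι → α => (x i, x j) := by fun_prop
  have hr := measurePreserving_update_update μ i j
  refine ⟨hm, ?_⟩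
  rw [← hr.map_eq, Measure.map_map hm hr.measurable]
  have : ((fun x : ι → α => (x i, x j)) ∘ fun z : (ι → α) × α × α =>
      Function.update (Function.update z.1 i z.2.1) j z.2.2) = Prod.snd := by
    ext z <;> simp [Function.update_of_ne hij]
  rw [this, ← Measure.snd, Measure.snd_prod]

theorem integral_eval_pair {ι : Type*} [Fintype ι] {i j : ι} (hij : i ≠ j) {g : I → I → ℝ}
    (hg : Measurable fun p : I × I => g p.1 p.2) :
    ∫ x : ι → I, g (x i) (x j) = ∫ p : I × I, g p.1 p.2 := by
  have h := measurePreserving_eval_pair (volume : Measure I) hij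
  have h2 := integral_map (μ := Measure.pi fun _ : ι => (volume : Measure I))
    h.measurable.aemeasurable (f := fun p : I × I => g p.1 p.2) hg.aestronglyMeasurable
  rw [h.map_eq] at h2
  exact h2.symm

/-- The second moment of the empirical distribution function. -/
theorem integral_card_sub_sq_le (k : ℕ) (t : ℝ) (h0 : 0 ≤ t) (h1 : t ≤ 1) :
    ∫ x : Fin k → I, (((Finset.univ.filter fun i => (x i : ℝ) ≤ t).card : ℝ) - k * t) ^ 2 ≤ k := by
  let f : I → ℝ := fun s => (Set.Iic (⟨t, h0, h1⟩ : I)).indicator 1 s - t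
  have hfm : Measurable f := (measurable_one.indicator measurableSet_Iic).sub_const t
  have hf1 : ∀ s, |f s| ≤ 1 := fun s => by
    by_cases hs : s ∈ Set.Iic (⟨t, h0, h1⟩ : I) <;> simp only [f, Set.indicator, hs, if_true,
      if_false, Pi.one_apply] <;> rw [abs_le] <;> constructor <;> linarith
  have hf0 : ∫ s, f s = 0 := by
    have hi : Integrable ((Set.Iic (⟨t, h0, h1⟩ : I)).indicator (1 : I → ℝ)) volume :=
      (integrable_indicator_iff measurableSet_Iic).2 (integrable_const (1 : ℝ)).integrableOn
    simp only [f]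
    rw [integral_sub hi (integrable_const t), integral_indicator_one measurableSet_Iic,
      measureReal_def, unitInterval.volume_Iic, ENNReal.toReal_ofReal h0]
    simp
  have hsq : ∀ x : Fin k → I,
      (((Finset.univ.filter fun i => (x i : ℝ) ≤ t).card : ℝ) - k * t) ^ 2 =
        ∑ i, ∑ j, f (x i) * f (x j) := fun x => by
    rw [← Finset.sum_mul_sum, sq]
    have : ((Finset.univ.filter fun i => (x i : ℝ) ≤ t).card : ℝ) - k * t = ∑ i, f (x i) := by
      simp only [f, Finset.sum_sub_distrib, Finset.sum_const, Finset.card_univ, Fintype.card_fin,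
        nsmul_eq_mul, Finset.card_filter, Set.indicator, Set.mem_Iic, Pi.one_apply]
      push_cast
      rfl
    rw [this]
  have hm : ∀ i j, Measurable fun x : Fin k → I => f (x i) * f (x j) := fun i j =>
    (hfm.comp (measurable_pi_apply i)).mul (hfm.comp (measurable_pi_apply j))
  have hb : ∀ i j (x : Fin k → I), |f (x i) * f (x j)| ≤ 1 := fun i j x => by
    rw [abs_mul]; exact mul_le_one₀ (hf1 _) (abs_nonneg _) (hf1 _)
  -- Independence kills the off-diagonal covariances of the centred indicators, leaving `k` diagonal
  -- terms.
  have hij : ∀ i j : Fin k, ∫ x : Fin k → I, f (x i) * f (x j) ≤ if i = j then 1 else 0 := by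
    intro i j
    split_ifs with h
    · exact (le_abs_self _).trans (abs_integral_le_of_abs_le (hb i j))
    · rw [integral_eval_pair h (g := fun s t => f s * f t)
        ((hfm.comp measurable_fst).mul (hfm.comp measurable_snd))]
      have := integral_prod_mul (μ := (volume : Measure I)) (ν := (volume : Measure I)) f f
      rw [hf0, zero_mul] at this
      exact this.le
  simp_rw [hsq]
  rw [integral_finsetSum _ fun i _ => integrable_finsetSum _ fun j _ =>
    integrable_of_abs_le (hm i j) 1 (hb i j)]
  calc _ ≤ ∑ i : Fin k, (1 : ℝ) := Finset.sum_le_sum fun i _ => by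
        rw [integral_finsetSum _ fun j _ => integrable_of_abs_le (hm i j) 1 (hb i j)]
        exact (Finset.sum_le_sum fun j _ => hij i j).trans_eq (by simp)
    _ = k := by simp

/-- If the empirical distribution function is close to the identity on a grid, then the order
statistics are close to their expected positions. -/
theorem abs_sort_sub_le {k N : ℕ} (hN : 0 < N) (x : Fin k → I) {η : ℝ} (hη : 0 ≤ η)
    (h : ∀ j : ℕ, j ≤ N → |((Finset.univ.filter fun i => (x i : ℝ) ≤ (j : ℝ) / N).card : ℝ) -
      k * ((j : ℝ) / N)| ≤ η * k) (i : Fin k) :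
    |(x (Tuple.sort x i) : ℝ) - (i : ℝ) / k| ≤ 1 / N + η := by
  have hk : (0 : ℝ) < k := by exact_mod_cast (Nat.zero_le i.1).trans_lt i.2
  have hN' : (0 : ℝ) < N := by exact_mod_cast hN
  have hmono : Monotone fun i => (x (Tuple.sort x i) : ℝ) := fun a b hab => Tuple.monotone_sort x hab
  have hcard : ∀ t : ℝ, (Finset.univ.filter fun i => (x (Tuple.sort x i) : ℝ) ≤ t).card =
      (Finset.univ.filter fun i => (x i : ℝ) ≤ t).card := fun t =>
    Finset.card_equiv (Tuple.sort x) fun i => by simp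
  -- With ranks counted from 0, the point of rank `i` is at most `t` exactly when more than `i`
  -- points are. This is applied at the grid points just above and just below `y`.
  have key : ∀ t : ℝ, (i : ℕ) < (Finset.univ.filter fun i => (x i : ℝ) ≤ t).card ↔
      (x (Tuple.sort x i) : ℝ) ≤ t := fun t => by
    rw [← hcard]
    exact Tuple.lt_card_le_iff_apply_le_of_monotone hmono
  set y : ℝ := ((x (Tuple.sort x i) : I) : ℝ)
  have hy0 : 0 ≤ y := (x (Tuple.sort x i)).2.1
  have hy1 : y ≤ 1 := (x (Tuple.sort x i)).2.2
  have hi0 : (0 : ℝ) ≤ (i : ℝ) / k := by positivity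
  have hc : ⌈(N : ℝ) * y⌉₊ ≤ N := Nat.ceil_le.2 (mul_le_of_le_one_right hN'.le hy1)
  have hc1 := Nat.le_ceil ((N : ℝ) * y)
  have hc2 := Nat.ceil_lt_add_one (show 0 ≤ (N : ℝ) * y by positivity)
  rw [abs_le]
  constructor
  · have h1 : y ≤ (⌈(N : ℝ) * y⌉₊ : ℝ) / N := by rw [le_div_iff₀ hN']; linarith
    have h2 : ((⌈(N : ℝ) * y⌉₊ : ℝ)) / N ≤ y + 1 / N := by
      rw [div_le_iff₀ hN', add_mul, one_div, inv_mul_cancel₀ hN'.ne']; linarith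
    have h3 := (key _).2 h1
    have h4 := (abs_le.1 (h _ hc)).2
    have h5 : (i : ℝ) ≤ ((Finset.univ.filter fun i => (x i : ℝ) ≤
      (⌈(N : ℝ) * y⌉₊ : ℝ) / N).card : ℝ) := by exact_mod_cast h3.le
    have h6 : (i : ℝ) / k ≤ (⌈(N : ℝ) * y⌉₊ : ℝ) / N + η := by
      rw [div_le_iff₀ hk]; linarith
    linarith
  -- At `y = 0` there is no grid point below, but the upper bound is then immediate.
  · rcases hy0.eq_or_lt with hy | hy
    · rw [← hy]
      have : (0 : ℝ) < 1 / N := by positivity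
      linarith
    · have hpos : 0 < ⌈(N : ℝ) * y⌉₊ := Nat.ceil_pos.2 (by positivity)
      obtain ⟨j, hj⟩ := Nat.exists_eq_succ_of_ne_zero hpos.ne'
      rw [hj] at hc hc1 hc2
      push_cast at hc1 hc2
      have h1 : (j : ℝ) / N < y := by rw [div_lt_iff₀ hN']; linarith
      have h2 : y ≤ (j : ℝ) / N + 1 / N := by rw [← add_div, le_div_iff₀ hN']; linarith
      have h3 := not_lt.1 ((key ((j : ℝ) / N)).not.2 (not_le.2 h1))
      have h4 := (abs_le.1 (h j (by omega))).1
      have h5 : ((Finset.univ.filter fun i => (x i : ℝ) ≤ (j : ℝ) / N).card : ℝ) ≤ (i : ℝ) := by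
        exact_mod_cast h3
      have h6 : (j : ℝ) / N - η ≤ (i : ℝ) / k := by
        rw [le_div_iff₀ hk]; linarith
      linarith

theorem abs_sub_cell_div_le {k : ℕ} [NeZero k] (x : I) :
    |((cell k x : ℕ) : ℝ) / k - x| ≤ 1 / k := by
  have hk : (0 : ℝ) < k := by exact_mod_cast NeZero.pos k
  by_cases hx : x = 0
  · subst hx
    have : ((cell k 0 : Fin k) : ℕ) = 0 := by simp [cell]
    rw [this]
    simp
  · obtain ⟨h1, h2⟩ := (cell_eq_iff hx (cell k x)).1 rfl
    rw [add_div] at h2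
    rw [abs_le]
    constructor <;> linarith [show (0 : ℝ) < 1 / k by positivity]

/-! ### The sampling lemma -/

theorem measurable_comp_cell {k : ℕ} [NeZero k] (A : Fin k → Fin k → ℝ) :
    Measurable fun p : I × I => A (cell k p.1) (cell k p.2) :=
  (measurable_of_countable fun q : Fin k × Fin k => A q.1 q.2).comp
    (((measurable_cell k).comp measurable_fst).prodMk ((measurable_cell k).comp measurable_snd))

theorem integrable_comp_cell {k : ℕ} [NeZero k] (A : Fin k → Fin k → ℝ) :
    Integrable fun p : I × I => A (cell k p.1) (cell k p.2) := by
  obtain ⟨C, hC⟩ := (Set.finite_range fun q : Fin k × Fin k => |A q.1 q.2|).bddAbove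
  exact integrable_of_abs_le (measurable_comp_cell A) C fun p =>
    hC ⟨(cell k p.1, cell k p.2), rfl⟩

theorem integral_comp_cell {k : ℕ} [NeZero k] (A : Fin k → Fin k → ℝ) :
    ∫ p : I × I, A (cell k p.1) (cell k p.2) = (∑ q : Fin k × Fin k, A q.1 q.2) / (k : ℝ) ^ 2 := by
  have h := setIntegral_cell A Set.univ Set.univ
  rw [Set.univ_prod_univ, setIntegral_univ] at h
  rw [h, Fintype.sum_prod_type, Finset.sum_div]
  refine Finset.sum_congr rfl fun i _ => ?_
  simp only [Set.inter_univ, measureReal_def, volume_cell_preimage,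
    ENNReal.toReal_ofReal (show (0 : ℝ) ≤ 1 / k by positivity)]
  rw [← Finset.sum_mul]
  ring

theorem GraphFun.integrable (W : GraphFun) : Integrable fun p : I × I => W.toFun p.1 p.2 :=
  integrable_of_abs_le W.measurable 1 fun p => by
    rw [abs_of_nonneg (W.nonneg _ _)]; exact W.le_one _ _

theorem ae_prod_ne_zero : ∀ᵐ p : I × I, p.1 ≠ 0 ∧ p.2 ≠ 0 := by
  have h := Measure.ae_ne (volume : Measure I) 0
  exact (Measure.quasiMeasurePreserving_fst.tendsto_ae.eventually h).and
    (Measure.quasiMeasurePreserving_snd.tendsto_ae.eventually h)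

/-- The deterministic core of the sampling lemma. The noise costs `a` in cut norm. The rest is
bounded in L¹ along a chain: `W` to `V` at the sample points (`b`, plus `1/k` for the diagonal), `V`
at the sample points to `V` at `p` (`c`), and `V` to `W` (`d`). -/
theorem cutNorm_ofGraph_comap_sub_le {k : ℕ} [NeZero k] (W : GraphFun) {V : I × I → ℝ}
    (hV : Integrable V) (hV0 : ∀ p, 0 ≤ V p) (hV1 : ∀ p, V p ≤ 1) (ω : SampleSpace k)
    (π : Equiv.Perm (Fin k)) {a b c d : ℝ} (ha : 0 ≤ a)
    (hX : ∑ q : Fin k × Fin k, (∑ i, edgeNoise W ω i q.1 * edgeNoise W ω i q.2) ^ 2 ≤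
      a ^ 4 * (k : ℝ) ^ 4)
    (hb : ∑ q : Fin k × Fin k, (if q.1 = q.2 then 0 else
      |W.toFun (ω.1 q.1) (ω.1 q.2) - V (ω.1 q.1, ω.1 q.2)|) ≤ b * (k : ℝ) ^ 2)
    (hc : ∀ p : I × I, |V (ω.1 (π (cell k p.1)), ω.1 (π (cell k p.2))) - V p| ≤ c)
    (hd : ∫ p : I × I, |W.toFun p.1 p.2 - V p| ≤ d) :
    cutNorm (fun x y => (ofGraph ((randomGraph k W ω).comap π)).toFun x y - W.toFun x y) ≤
      a + (b + 1 / k + c + d) := by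
  classical
  have hk : (0 : ℝ) < k := by exact_mod_cast NeZero.pos k
  refine cutNorm_le fun S T hS hT => ?_
  let X : Fin k → Fin k → ℝ := fun i j => edgeNoise W ω (π i) (π j)
  let H : Fin k → Fin k → ℝ := fun i j =>
    if i = j then 0 else W.toFun (ω.1 (π i)) (ω.1 (π j))
  -- On diagonal cells `H` is 0 and `V` is at most 1, hence the value 1 there; these cells have
  -- total area `1/k`.
  let E : Fin k → Fin k → ℝ := fun i j =>
    if i = j then 1 else |W.toFun (ω.1 (π i)) (ω.1 (π j)) - V (ω.1 (π i), ω.1 (π j))|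
  have hWV : Integrable fun p : I × I => |W.toFun p.1 p.2 - V p| := (W.integrable.sub hV).abs
  have hEc : Integrable fun p : I × I => E (cell k p.1) (cell k p.2) + c :=
    (integrable_comp_cell E).add (integrable_const c)
  have hDi : Integrable fun p : I × I => H (cell k p.1) (cell k p.2) - W.toFun p.1 p.2 :=
    (integrable_comp_cell H).sub W.integrable
  have h1 : ∫ p in S ×ˢ T, ((ofGraph ((randomGraph k W ω).comap π)).toFun p.1 p.2 -
      W.toFun p.1 p.2) = (∫ p in S ×ˢ T, X (cell k p.1) (cell k p.2)) +
        ∫ p in S ×ˢ T, (H (cell k p.1) (cell k p.2) - W.toFun p.1 p.2) := by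
    rw [← integral_add (integrable_comp_cell X).integrableOn hDi.integrableOn]
    refine integral_congr_ae (ae_restrict_of_ae ?_)
    filter_upwards [ae_prod_ne_zero] with p hp
    rw [ofGraph_apply _ hp.1 hp.2]
    by_cases hij : cell k p.1 = cell k p.2
    · simp [X, H, edgeNoise, hij]
    · simp only [SimpleGraph.comap_adj, randomGraph, ne_eq, EmbeddingLike.apply_eq_iff_eq, hij,
        not_false_eq_true, true_and, X, H, edgeNoise, if_false]
      ring
  have h2 : |∫ p in S ×ˢ T, X (cell k p.1) (cell k p.2)| ≤ a := by
    refine abs_setIntegral_cell_le X ha (le_of_eq_of_le ?_ hX) S T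
    rw [← Equiv.sum_comp (π.prodCongr π) fun q : Fin k × Fin k =>
      (∑ i, edgeNoise W ω i q.1 * edgeNoise W ω i q.2) ^ 2]
    refine Finset.sum_congr rfl fun q _ => ?_
    rw [← Equiv.sum_comp π fun i => edgeNoise W ω i (π.prodCongr π q).1 *
      edgeNoise W ω i (π.prodCongr π q).2]
    rfl
  have h3 : ∀ p : I × I, |H (cell k p.1) (cell k p.2) - W.toFun p.1 p.2| ≤
      E (cell k p.1) (cell k p.2) + c + |W.toFun p.1 p.2 - V p| := fun p => by
    have hE : |H (cell k p.1) (cell k p.2) - V (ω.1 (π (cell k p.1)), ω.1 (π (cell k p.2)))| ≤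
        E (cell k p.1) (cell k p.2) := by
      by_cases hij : cell k p.1 = cell k p.2
      · simp only [H, E, hij, if_true, zero_sub, abs_neg]
        rw [abs_of_nonneg (hV0 _)]
        exact hV1 _
      · simp only [H, E, hij, if_false, le_refl]
    have := hc p
    calc _ ≤ |H (cell k p.1) (cell k p.2) - V (ω.1 (π (cell k p.1)), ω.1 (π (cell k p.2)))| +
          |V (ω.1 (π (cell k p.1)), ω.1 (π (cell k p.2))) - W.toFun p.1 p.2| := abs_sub_le _ _ _
      _ ≤ _ + (|V (ω.1 (π (cell k p.1)), ω.1 (π (cell k p.2))) - V p| + |V p - W.toFun p.1 p.2|) :=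
          add_le_add_right (abs_sub_le _ _ _) _
      _ ≤ _ := by rw [abs_sub_comm (V p)]; linarith
  have hEi : ∫ p : I × I, E (cell k p.1) (cell k p.2) ≤ b + 1 / k := by
    rw [integral_comp_cell, div_le_iff₀ (by positivity)]
    have hsum : ∑ q : Fin k × Fin k, E q.1 q.2 = (∑ q : Fin k × Fin k, (if q.1 = q.2 then 0 else
        |W.toFun (ω.1 q.1) (ω.1 q.2) - V (ω.1 q.1, ω.1 q.2)|)) +
        ∑ q : Fin k × Fin k, (if q.1 = q.2 then (1 : ℝ) else 0) := by
      rw [← Equiv.sum_comp (π.prodCongr π) fun q : Fin k × Fin k => if q.1 = q.2 then (0 : ℝ) else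
        |W.toFun (ω.1 q.1) (ω.1 q.2) - V (ω.1 q.1, ω.1 q.2)|, ← Finset.sum_add_distrib]
      refine Finset.sum_congr rfl fun q _ => ?_
      by_cases hq : q.1 = q.2 <;> simp [E, hq]
    have hdiag : ∑ q : Fin k × Fin k, (if q.1 = q.2 then (1 : ℝ) else 0) = k := by
      rw [Fintype.sum_prod_type]
      simp
    rw [hsum, hdiag, add_mul]
    have : 1 / (k : ℝ) * k ^ 2 = k := by field_simp
    linarith
  have h4 : |∫ p in S ×ˢ T, (H (cell k p.1) (cell k p.2) - W.toFun p.1 p.2)| ≤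
      b + 1 / k + c + d := by
    calc _ ≤ ∫ p in S ×ˢ T, |H (cell k p.1) (cell k p.2) - W.toFun p.1 p.2| :=
          abs_integral_le_integral_abs
      _ ≤ ∫ p : I × I, |H (cell k p.1) (cell k p.2) - W.toFun p.1 p.2| :=
          setIntegral_le_integral hDi.abs (Eventually.of_forall fun _ => abs_nonneg _)
      _ ≤ ∫ p : I × I, (E (cell k p.1) (cell k p.2) + c + |W.toFun p.1 p.2 - V p|) :=
          integral_mono hDi.abs (hEc.add hWV) h3
      _ = (∫ p : I × I, E (cell k p.1) (cell k p.2)) + c + ∫ p : I × I, |W.toFun p.1 p.2 - V p| := by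
          rw [integral_add hEc hWV,
            integral_add (integrable_comp_cell E) (integrable_const c)]
          simp
      _ ≤ _ := by linarith
  rw [h1]
  exact (abs_add_le _ _).trans (add_le_add h2 h4)

/-- Bounded continuous functions are dense in L¹, and clipping to `[0,1]` does not increase the
distance to the `[0,1]`-valued `W`. -/
theorem GraphFun.exists_continuous_integral_abs_sub_le (W : GraphFun) {d : ℝ} (hd : 0 < d) :
    ∃ V : I × I → ℝ, Continuous V ∧ (∀ p, 0 ≤ V p) ∧ (∀ p, V p ≤ 1) ∧
      ∫ p : I × I, |W.toFun p.1 p.2 - V p| ≤ d := by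
  obtain ⟨g, hg, hgi⟩ := W.integrable.exists_boundedContinuous_integral_sub_le hd
  have hV : Continuous fun p => max 0 (min 1 (g p)) := by fun_prop
  have hV0 : ∀ p, 0 ≤ max 0 (min 1 (g p)) := fun p => le_max_left _ _
  have hV1 : ∀ p, max 0 (min 1 (g p)) ≤ 1 := fun p => max_le zero_le_one (min_le_left _ _)
  refine ⟨fun p => max 0 (min 1 (g p)), hV, hV0, hV1, le_trans ?_ hg⟩
  have hVi : Integrable fun p => max 0 (min 1 (g p)) :=
    integrable_of_abs_le hV.measurable 1 fun p => by rw [abs_of_nonneg (hV0 p)]; exact hV1 p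
  refine integral_mono (W.integrable.sub hVi).abs (W.integrable.sub hgi).norm fun p => ?_
  have h0 := W.nonneg p.1 p.2
  have h1 := W.le_one p.1 p.2
  simp only [Real.norm_eq_abs]
  rcases le_total 1 (g p) with h | h
  · rw [min_eq_left h, max_eq_right zero_le_one, abs_sub_comm, abs_sub_comm _ (g p),
      abs_of_nonneg (by linarith), abs_of_nonneg (by linarith)]
    linarith
  · rw [min_eq_right h]
    rcases le_total 0 (g p) with h' | h'
    · rw [max_eq_right h']
    · rw [max_eq_left h', abs_of_nonneg (by linarith), abs_of_nonneg (by linarith)]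
      linarith

theorem measureReal_ge_le_div {α : Type*} [MeasurableSpace α] {μ : Measure α} {f : α → ℝ}
    (hf0 : ∀ x, 0 ≤ f x) (hf : Integrable f μ) {A B : ℝ} (hA : 0 < A) (hB : ∫ x, f x ∂μ ≤ B) :
    μ.real {x | A ≤ f x} ≤ B / A := by
  rw [le_div_iff₀ hA, mul_comm]
  exact (mul_meas_ge_le_integral_of_nonneg (Eventually.of_forall hf0) hf A).trans hB

theorem volume_real_edgeNoise_le {k : ℕ} (hk : 0 < k) (W : GraphFun) {a : ℝ} (ha : 0 < a) :
    (volume : Measure (SampleSpace k)).real {ω | a ^ 4 * (k : ℝ) ^ 4 ≤ ∑ q : Fin k × Fin k,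
      (∑ i, edgeNoise W ω i q.1 * edgeNoise W ω i q.2) ^ 2} ≤ 2 / a ^ 4 / k := by
  have hk' : (0 : ℝ) < k := by exact_mod_cast hk
  refine (measureReal_ge_le_div (fun ω => Finset.sum_nonneg fun q _ => sq_nonneg _) ?_
    (by positivity) (integral_sum_edgeNoise_le W)).trans_eq (by field_simp)
  refine integrable_finsetSum _ fun q _ => integrable_of_abs_le
    ((Finset.measurable_sum _ fun i _ =>
      (measurable_edgeNoise W _ _).mul (measurable_edgeNoise W _ _)).pow_const 2)
      ((k : ℝ) ^ 2) fun ω => ?_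
  rw [abs_pow]
  refine pow_le_pow_left₀ (abs_nonneg _) ((Finset.abs_sum_le_sum_abs _ _).trans ?_) 2
  calc _ ≤ ∑ _i : Fin k, (1 : ℝ) := Finset.sum_le_sum fun i _ => by
        rw [abs_mul]
        exact mul_le_one₀ (abs_edgeNoise_le_one _ _ _ _) (abs_nonneg _)
          (abs_edgeNoise_le_one _ _ _ _)
    _ = k := by simp

/-- Markov: two distinct sample points are independent and uniform, so each off-diagonal term has
mean at most `d`. The bound does not decay with `k`, so `d` must be small compared with `b`. -/
theorem volume_real_sum_abs_sub_le {k : ℕ} (hk : 0 < k) (W : GraphFun) {V : I × I → ℝ}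
    (hV : Measurable V) (hV0 : ∀ p, 0 ≤ V p) (hV1 : ∀ p, V p ≤ 1) {b d : ℝ} (hb : 0 < b)
    (hd : ∫ p : I × I, |W.toFun p.1 p.2 - V p| ≤ d) :
    (volume : Measure (SampleSpace k)).real {ω | b * (k : ℝ) ^ 2 ≤ ∑ q : Fin k × Fin k,
      (if q.1 = q.2 then 0 else
        |W.toFun (ω.1 q.1) (ω.1 q.2) - V (ω.1 q.1, ω.1 q.2)|)} ≤ d / b := by
  have hk' : (0 : ℝ) < k := by exact_mod_cast hk
  have hd0 : 0 ≤ d := (integral_nonneg fun p => abs_nonneg _).trans hd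
  let D : I → I → ℝ := fun x y => |W.toFun x y - V (x, y)|
  have hD : Measurable fun p : I × I => D p.1 p.2 := (W.measurable.sub hV).abs
  have hD1 : ∀ x y, |D x y| ≤ 1 := fun x y => by
    have h0 := W.nonneg x y
    have h1 := W.le_one x y
    have h2 := hV0 (x, y)
    have h3 := hV1 (x, y)
    simp only [D, abs_abs]
    rw [abs_le]; constructor <;> linarith
  have hi : ∀ q : Fin k × Fin k, Integrable fun ω : SampleSpace k =>
      if q.1 = q.2 then 0 else D (ω.1 q.1) (ω.1 q.2) := fun q => by
    by_cases hq : q.1 = q.2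
    · simp only [hq, if_true]; exact integrable_const _
    · simp only [hq, if_false]
      exact integrable_of_abs_le
        (hD.comp (f := fun ω : SampleSpace k => (ω.1 q.1, ω.1 q.2)) (by fun_prop)) 1
        fun ω => hD1 _ _
  have hint : ∫ ω : SampleSpace k, ∑ q : Fin k × Fin k,
      (if q.1 = q.2 then 0 else D (ω.1 q.1) (ω.1 q.2)) ≤ d * (k : ℝ) ^ 2 := by
    rw [integral_finsetSum _ fun q _ => hi q]
    calc _ ≤ ∑ _q : Fin k × Fin k, d := Finset.sum_le_sum fun q _ => by
          by_cases hq : q.1 = q.2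
          · simpa only [hq, if_true, integral_zero] using hd0
          · simp only [hq, if_false]
            refine le_of_eq_of_le ?_ hd
            rw [← integral_eval_pair hq hD]
            refine (integral_fun_fst (μ := (volume : Measure (Fin k → I)))
              (ν := (volume : Measure (Sym2 (Fin k) → I)))
              fun x : Fin k → I => D (x q.1) (x q.2)).trans ?_
            simp
      _ = d * (k : ℝ) ^ 2 := by
          simp only [Finset.sum_const, Finset.card_univ, Fintype.card_prod, Fintype.card_fin,
            nsmul_eq_mul]
          push_cast; ring
  refine (measureReal_ge_le_div (fun ω => Finset.sum_nonneg fun q _ => ?_)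
    (integrable_finsetSum _ fun q _ => hi q) (by positivity) hint).trans_eq (by field_simp)
  split_ifs
  exacts [le_rfl, abs_nonneg _]

theorem volume_real_card_sub_le {k : ℕ} (hk : 0 < k) {t η : ℝ} (h0 : 0 ≤ t) (h1 : t ≤ 1)
    (hη : 0 < η) :
    (volume : Measure (SampleSpace k)).real
      {ω | (η * k) ^ 2 ≤ (((Finset.univ.filter fun i => (ω.1 i : ℝ) ≤ t).card : ℝ) - k * t) ^ 2} ≤
      1 / η ^ 2 / k := by
  have hk' : (0 : ℝ) < k := by exact_mod_cast hk
  refine (measureReal_ge_le_div (B := k) (fun ω => sq_nonneg _) ?_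
    (by positivity) ?_).trans_eq (by field_simp)
  · refine integrable_of_abs_le ?_ ((k : ℝ) ^ 2) fun ω => ?_
    · simp only [Finset.card_filter]
      push_cast
      refine ((Finset.measurable_sum _ fun i _ => Measurable.ite ?_ measurable_const
        measurable_const).sub_const _).pow_const 2
      exact measurableSet_le (by fun_prop) measurable_const
    · have hc : ((Finset.univ.filter fun i => (ω.1 i : ℝ) ≤ t).card : ℝ) ≤ k := by
        exact_mod_cast (Finset.card_le_univ _).trans_eq (Fintype.card_fin k)
      have hc0 : (0 : ℝ) ≤ ((Finset.univ.filter fun i => (ω.1 i : ℝ) ≤ t).card : ℝ) :=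
        Nat.cast_nonneg _
      rw [abs_pow]
      refine pow_le_pow_left₀ (abs_nonneg _) (abs_le.2 ⟨?_, ?_⟩) 2 <;> nlinarith
  · refine le_of_eq_of_le ?_ (integral_card_sub_sq_le k t h0 h1)
    refine (integral_fun_fst (μ := (volume : Measure (Fin k → I)))
      (ν := (volume : Measure (Sym2 (Fin k) → I))) fun x : Fin k → I =>
        (((Finset.univ.filter fun i => (x i : ℝ) ≤ t).card : ℝ) - k * t) ^ 2).trans ?_
    simp

/-- With high probability, a large `W`-random graph can be relabeled so that it is close to `W`
in the cut norm. -/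
theorem eventually_volume_real_cutNorm_le (W : GraphFun) {ε : ℝ} (hε : 0 < ε) :
    ∀ᶠ k : ℕ in atTop, (volume : Measure (SampleSpace k)).real
      {ω | ¬ ∃ π : Equiv.Perm (Fin k), cutNorm (fun x y =>
        (ofGraph ((randomGraph k W ω).comap π)).toFun x y - W.toFun x y) ≤ ε} ≤ ε := by
  set a := ε / 4 with ha
  -- The first entry bounds the L¹ error, keeping the total within `ε`; the second makes the Markov
  -- bound `d / a` at most `ε / 3`, leaving `ε / 2` for the events whose probability tends to 0.
  set d := min (ε / 8) (ε ^ 2 / 12) with hd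
  have ha0 : 0 < a := by positivity
  have hd0 : 0 < d := by positivity
  obtain ⟨V, hVc, hV0, hV1, hVW⟩ := W.exists_continuous_integral_abs_sub_le hd0
  obtain ⟨δ, hδ, hVδ⟩ := Metric.uniformContinuous_iff.1
    (CompactSpace.uniformContinuous_of_continuous hVc) (ε / 8) (by positivity)
  -- The grid step, the empirical deviation and the cell width each cost at most `η`, so a sorted
  -- point stays within `δ` of every point of its cell.
  set η := δ / 4 with hη
  have hη0 : 0 < η := by positivity
  obtain ⟨n, hn⟩ := exists_nat_one_div_lt hη0
  set N := n + 1 with hN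
  have hN0 : 0 < N := Nat.succ_pos n
  have hN1 : 1 / (N : ℝ) < η := by rw [hN]; exact_mod_cast hn
  have hlim : ∀ C : ℝ, ∀ c : ℝ, 0 < c → ∀ᶠ k : ℕ in atTop, C / k ≤ c := fun C c hc =>
    ((tendsto_const_nhds.div_atTop tendsto_natCast_atTop_atTop).eventually_lt_const hc).mono
      fun _ h => h.le
  filter_upwards [hlim (2 / a ^ 4 + (N + 1) * (1 / η ^ 2)) (ε / 2) (by positivity),
    hlim 1 (ε / 8) (by positivity), hlim 1 η hη0, eventually_gt_atTop 0] with k hk1 hk2 hk3 hk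
  have : NeZero k := ⟨hk.ne'⟩
  have hk' : (0 : ℝ) < k := by exact_mod_cast hk
  let B₁ : Set (SampleSpace k) := {ω | a ^ 4 * (k : ℝ) ^ 4 ≤ ∑ q : Fin k × Fin k,
    (∑ i, edgeNoise W ω i q.1 * edgeNoise W ω i q.2) ^ 2}
  let B₂ : Set (SampleSpace k) := {ω | a * (k : ℝ) ^ 2 ≤ ∑ q : Fin k × Fin k,
    (if q.1 = q.2 then 0 else |W.toFun (ω.1 q.1) (ω.1 q.2) - V (ω.1 q.1, ω.1 q.2)|)}
  let B₃ : ℕ → Set (SampleSpace k) := fun j => {ω | (η * k) ^ 2 ≤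
    (((Finset.univ.filter fun i => (ω.1 i : ℝ) ≤ (j : ℝ) / N).card : ℝ) - k * ((j : ℝ) / N)) ^ 2}
  have hsub : {ω : SampleSpace k | ¬ ∃ π : Equiv.Perm (Fin k), cutNorm (fun x y =>
      (ofGraph ((randomGraph k W ω).comap π)).toFun x y - W.toFun x y) ≤ ε} ⊆
      B₁ ∪ B₂ ∪ ⋃ j ∈ Finset.range (N + 1), B₃ j := by
    intro ω hω
    by_contra hcon
    simp only [Set.mem_union, not_or, Set.mem_iUnion, not_exists, B₁, B₂, B₃, Set.mem_ofPred_eq,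
      not_le, Finset.mem_range] at hcon
    obtain ⟨⟨h1, h2⟩, h3⟩ := hcon
    refine hω ⟨Tuple.sort ω.1, ?_⟩
    have hsort := abs_sort_sub_le hN0 ω.1 hη0.le fun j hj =>
      (abs_lt_of_sq_lt_sq (h3 j (Nat.lt_succ_of_le hj)) (by positivity)).le
    have hclose : ∀ y : I, |(ω.1 (Tuple.sort ω.1 (cell k y)) : ℝ) - y| < δ := fun y => by
      have h4 := hsort (cell k y)
      have h5 := abs_sub_cell_div_le (k := k) y
      calc _ ≤ _ + _ := abs_sub_le _ (((cell k y : ℕ) : ℝ) / k) _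
        _ < δ := by linarith
    refine (cutNorm_ofGraph_comap_sub_le W (b := a) (c := ε / 8) (d := d)
      (integrable_of_abs_le hVc.measurable 1 fun p => by
        rw [abs_of_nonneg (hV0 p)]; exact hV1 p) hV0 hV1 ω (Tuple.sort ω.1) ha0.le h1.le h2.le
      (fun p => ?_) hVW).trans ?_
    · have h6 := hVδ (a := (ω.1 (Tuple.sort ω.1 (cell k p.1)), ω.1 (Tuple.sort ω.1 (cell k p.2))))
        (b := p) (max_lt (hclose p.1) (hclose p.2))
      exact h6.le
    · have : d ≤ ε / 8 := min_le_left _ _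
      linarith
  have hP1 := volume_real_edgeNoise_le hk W ha0
  have hP2 := volume_real_sum_abs_sub_le hk W hVc.measurable hV0 hV1 ha0 hVW
  have hP3 : (volume : Measure (SampleSpace k)).real (⋃ j ∈ Finset.range (N + 1), B₃ j) ≤
      (N + 1) * (1 / η ^ 2 / k) := by
    refine (measureReal_biUnion_finset_le _ _).trans ?_
    calc _ ≤ ∑ _j ∈ Finset.range (N + 1), 1 / η ^ 2 / (k : ℝ) :=
          Finset.sum_le_sum fun j hj => by
            have hjN : (j : ℝ) ≤ N := by
              exact_mod_cast Nat.lt_succ_iff.1 (Finset.mem_range.1 hj)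
            exact volume_real_card_sub_le hk (by positivity)
              (div_le_one_of_le₀ hjN (Nat.cast_nonneg _)) hη0
      _ = _ := by simp
  have hP2' : d / a ≤ ε / 3 := by
    have : d ≤ ε ^ 2 / 12 := min_le_right _ _
    rw [div_le_iff₀ ha0, ha]
    nlinarith
  have hsum : 2 / a ^ 4 / k + (N + 1) * (1 / η ^ 2 / k) =
      (2 / a ^ 4 + (N + 1) * (1 / η ^ 2)) / (k : ℝ) := by ring
  calc _ ≤ (volume : Measure (SampleSpace k)).real
        (B₁ ∪ B₂ ∪ ⋃ j ∈ Finset.range (N + 1), B₃ j) := measureReal_mono hsub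
    _ ≤ _ := (measureReal_union_le _ _).trans (add_le_add_left (measureReal_union_le _ _) _)
    _ ≤ ε := by linarith

/-! ### The closure of a graph property -/

/-- The identity map suffices as `φ`: any rearrangement can be made on the nodes of the graph
instead. -/
theorem GraphProperty.mem_closure_of_forall_exists {P : GraphProperty} {W : GraphFun}
    (h : ∀ ε : ℝ, 0 < ε → ∀ K : ℕ, ∃ k, K ≤ k ∧ ∃ G : SimpleGraph (Fin k), P.Holds G ∧
      cutNorm (fun x y => (ofGraph G).toFun x y - W.toFun x y) ≤ ε) : W ∈ P.closure := by
  choose N hN G hG hd using fun m : ℕ => h (1 / ((m : ℝ) + 1)) Nat.one_div_pos_of_nat m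
  exact ⟨N, G, hG, tendsto_atTop_mono hN tendsto_id,
    squeeze_zero (fun m => cutDist_nonneg _ _) (fun m => (cutDist_le_cutNorm _ _).trans (hd m))
      tendsto_one_div_add_atTop_nhds_zero_nat⟩

theorem nonempty_compl_union_of_measureReal {α : Type*} [MeasurableSpace α] {μ : Measure α}
    [IsProbabilityMeasure μ] {A B : Set α} (h : μ.real A + μ.real B < 1) :
    ∃ x, x ∉ A ∧ x ∉ B := by
  by_contra! hcon
  have : A ∪ B = Set.univ := Set.eq_univ_of_forall fun x => by
    by_cases hx : x ∈ A
    exacts [Or.inl hx, Or.inr (hcon x hx)]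
  have h2 := measureReal_union_le (μ := μ) A B
  rw [this, probReal_univ] at h2
  linarith

/-- An injective map inducing `F` would make `F` an induced subgraph of `G`, so only collisions
contribute. The condition `1 ≤ k` makes the range nonempty, as heredity requires. -/
theorem tInd_ofGraph_le_of_hereditary {P : GraphProperty} (hP : P.Hereditary) {k n : ℕ}
    (hk : 1 ≤ k) (hn : 0 < n) {G : SimpleGraph (Fin n)} (hG : P.Holds G) {F : SimpleGraph (Fin k)}
    (hF : ¬ P.Holds F) : tInd F (ofGraph G) ≤ k ^ 2 / n := by
  classical
  have : NeZero n := ⟨hn.ne'⟩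
  have : Nonempty (Fin k) := ⟨⟨0, hk⟩⟩
  rw [← volume_real_randomGraph_eq, volume_real_randomGraph_ofGraph G fun H => H = F]
  refine le_trans (div_le_div_of_nonneg_right ?_ (by positivity)) (card_not_injective_le hn)
  refine Nat.cast_le.2 (Finset.card_le_card fun c hc => ?_)
  simp only [Finset.mem_filter, Finset.mem_univ, true_and] at hc ⊢
  exact fun hinj => hF (hc ▸ (P.holds_comap_iff_holds_induce G hinj).2
    (hP G hG _ (Set.range_nonempty c)))

theorem tInd_eq_zero_of_mem_closure {P : GraphProperty} (hP : P.Hereditary) {W : GraphFun}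
    (hW : W ∈ P.closure) {k : ℕ} (hk : 1 ≤ k) {F : SimpleGraph (Fin k)} (hF : ¬ P.Holds F) :
    tInd F W = 0 := by
  obtain ⟨N, G, hG, hN, hd⟩ := hW
  refine le_antisymm ?_ (tInd_nonneg F W)
  have hlim : Tendsto (fun m => (k : ℝ) ^ 2 / N m + k ^ 2 * cutDist (ofGraph (G m)) W) atTop
      (𝓝 (0 + k ^ 2 * 0)) :=
    (tendsto_const_nhds.div_atTop (tendsto_natCast_atTop_atTop.comp hN)).add (hd.const_mul _)
  rw [mul_zero, add_zero] at hlim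
  refine ge_of_tendsto hlim ?_
  filter_upwards [hN.eventually_gt_atTop 0] with m hm
  have h1 := tInd_ofGraph_le_of_hereditary hP hk hm (hG m) hF
  have h2 := (abs_le.1 (abs_tInd_sub_tInd_le_cutDist F (ofGraph (G m)) W)).1
  linarith

theorem GraphProperty.holds_comap_perm (P : GraphProperty) {k : ℕ} {G : SimpleGraph (Fin k)}
    (hG : P.Holds G) (π : Equiv.Perm (Fin k)) : P.Holds (G.comap π) :=
  (P.holds_congr (SimpleGraph.Iso.comap π G)).2 hG

theorem mem_closure_of_null {P : GraphProperty} {W : GraphFun} (h : ∀ k : ℕ, 1 ≤ k →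
    (volume : Measure (SampleSpace k)) {ω | ¬ P.Holds (randomGraph k W ω)} = 0) :
    W ∈ P.closure := by
  refine GraphProperty.mem_closure_of_forall_exists fun ε hε K => ?_
  obtain ⟨k, hk, hkK, hk1⟩ := ((eventually_volume_real_cutNorm_le W
    -- The cap `1 / 2` leaves positive probability for the sample to be close to `W` and in `P` at
    -- once.
    (lt_min hε (show (0 : ℝ) < 1 / 2 by norm_num))).and
    ((eventually_ge_atTop K).and (eventually_ge_atTop 1))).exists
  have h0 : (volume : Measure (SampleSpace k)).real {ω | ¬ P.Holds (randomGraph k W ω)} = 0 := by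
    rw [measureReal_def, h k hk1, ENNReal.toReal_zero]
  obtain ⟨ω, h1, h2⟩ := nonempty_compl_union_of_measureReal (lt_of_le_of_lt
    (add_le_add hk h0.le) (by linarith [min_le_right ε (1 / 2 : ℝ)]))
  obtain ⟨π, hπ⟩ := not_not.1 h1
  exact ⟨k, hkK, _, P.holds_comap_perm (not_not.1 h2) π, hπ.trans (min_le_left _ _)⟩

/-! ### Edit distance -/

theorem card_adj_ne_le {k : ℕ} (G H : SimpleGraph (Fin k)) [DecidablePred
    fun q : Fin k × Fin k => ¬(G.Adj q.1 q.2 ↔ H.Adj q.1 q.2)] :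
    (Finset.univ.filter fun q : Fin k × Fin k => ¬(G.Adj q.1 q.2 ↔ H.Adj q.1 q.2)).card ≤
      2 * editDist G H := by
  classical
  refine (Finset.card_le_mul_card_image (f := fun q : Fin k × Fin k => s(q.1, q.2)) _ 2
    fun e _ => ?_).trans (Nat.mul_le_mul_left 2 ?_)
  · induction e with
    | _ a b =>
      refine (Finset.card_le_card (t := {(a, b), (b, a)}) fun q hq => ?_).trans Finset.card_le_two
      have := (Finset.mem_filter.1 hq).2
      rcases Sym2.eq_iff.1 this with ⟨h1, h2⟩ | ⟨h1, h2⟩ <;> simp [Prod.ext_iff, h1, h2]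
  · rw [editDist, Set.ncard_eq_toFinset_card']
    refine Finset.card_le_card fun e he => ?_
    obtain ⟨q, hq, rfl⟩ := Finset.mem_image.1 he
    have hq := (Finset.mem_filter.1 hq).2
    rw [Set.mem_toFinset, Set.mem_symmDiff, SimpleGraph.mem_edgeSet, SimpleGraph.mem_edgeSet]
    tauto

/-- Each edited edge changes the associated function on at most two cells of area `1 / k ^ 2`, and
the cut norm is dominated by the L¹ norm. -/
theorem cutNorm_ofGraph_comap_sub_le_add_editDist {k : ℕ} (hk : 0 < k) (G H : SimpleGraph (Fin k))
    (π : Equiv.Perm (Fin k)) (W : GraphFun) :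
    cutNorm (fun x y => (ofGraph (H.comap π)).toFun x y - W.toFun x y) ≤
      cutNorm (fun x y => (ofGraph (G.comap π)).toFun x y - W.toFun x y) +
        2 * editDist G H / (k : ℝ) ^ 2 := by
  classical
  have : NeZero k := ⟨hk.ne'⟩
  refine cutNorm_le fun S T hS hT => ?_
  have hC : ∀ x y, |(ofGraph (G.comap π)).toFun x y - W.toFun x y| ≤ 1 := fun x y => by
    have h1 := W.nonneg x y
    have h2 := W.le_one x y
    have h3 := (ofGraph (G.comap π)).nonneg x y
    have h4 := (ofGraph (G.comap π)).le_one x y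
    rw [abs_le]; constructor <;> linarith
  have h1 := abs_setIntegral_le_cutNorm hC hS hT
  have hG := (ofGraph (G.comap π)).integrable
  have hH := (ofGraph (H.comap π)).integrable
  let A : Fin k → Fin k → ℝ := fun i j =>
    if ¬(G.Adj (π i) (π j) ↔ H.Adj (π i) (π j)) then 1 else 0
  have h2 : ∫ p : I × I, |(ofGraph (H.comap π)).toFun p.1 p.2 - (ofGraph (G.comap π)).toFun p.1 p.2|
      ≤ 2 * editDist G H / (k : ℝ) ^ 2 := by
    have h3 : ∫ p : I × I,
        |(ofGraph (H.comap π)).toFun p.1 p.2 - (ofGraph (G.comap π)).toFun p.1 p.2| =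
        ∫ p : I × I, A (cell k p.1) (cell k p.2) := by
      refine integral_congr_ae ?_
      filter_upwards [ae_prod_ne_zero] with p hp
      rw [ofGraph_apply _ hp.1 hp.2, ofGraph_apply _ hp.1 hp.2]
      by_cases h4 : G.Adj (π (cell k p.1)) (π (cell k p.2)) <;>
        by_cases h5 : H.Adj (π (cell k p.1)) (π (cell k p.2)) <;> simp [A, h4, h5]
    rw [h3, integral_comp_cell]
    refine div_le_div_of_nonneg_right ?_ (by positivity)
    have h4 : ∑ q : Fin k × Fin k, A q.1 q.2 = (Finset.univ.filter fun q : Fin k × Fin k =>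
        ¬(G.Adj q.1 q.2 ↔ H.Adj q.1 q.2)).card := by
      rw [Finset.card_filter, ← Equiv.sum_comp (π.prodCongr π) fun q : Fin k × Fin k =>
        if ¬(G.Adj q.1 q.2 ↔ H.Adj q.1 q.2) then 1 else 0]
      push_cast
      rfl
    rw [h4]
    exact_mod_cast card_adj_ne_le G H
  have h3 : ∫ p in S ×ˢ T, ((ofGraph (H.comap π)).toFun p.1 p.2 - W.toFun p.1 p.2) =
      (∫ p in S ×ˢ T, ((ofGraph (G.comap π)).toFun p.1 p.2 - W.toFun p.1 p.2)) +
      ∫ p in S ×ˢ T, ((ofGraph (H.comap π)).toFun p.1 p.2 - (ofGraph (G.comap π)).toFun p.1 p.2) := by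
    refine Eq.trans ?_ (integral_add (hG.sub W.integrable).integrableOn (hH.sub hG).integrableOn)
    refine integral_congr_ae (Eventually.of_forall fun p => ?_)
    dsimp only
    ring
  have h4 : |∫ p in S ×ˢ T,
      ((ofGraph (H.comap π)).toFun p.1 p.2 - (ofGraph (G.comap π)).toFun p.1 p.2)| ≤
      2 * editDist G H / (k : ℝ) ^ 2 :=
    (abs_integral_le_integral_abs.trans (setIntegral_le_integral (hH.sub hG).abs
      (Eventually.of_forall fun _ => abs_nonneg _))).trans h2
  rw [h3]
  exact (abs_add_le _ _).trans (add_le_add h1 h4)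

theorem exists_holds_of_d1To_lt {k : ℕ} (hk : 0 < k) {G : SimpleGraph (Fin k)} {P : GraphProperty}
    {ε : ℝ} (h : d1To G P < ENNReal.ofReal ε) :
    ∃ H : SimpleGraph (Fin k), P.Holds H ∧ (editDist G H : ℝ) / (k : ℝ) ^ 2 ≤ ε := by
  have hk' : (0 : ℝ) < k := by exact_mod_cast hk
  have hε : 0 < ε := ENNReal.ofReal_pos.1 (bot_le.trans_lt h)
  have hk0 : ((k : ℝ≥0∞) ^ 2) ≠ 0 := by
    simpa using hk.ne'
  have hkt : ((k : ℝ≥0∞) ^ 2) ≠ ∞ := by simp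
  rw [d1To, Nat.card_fin, ENNReal.div_lt_iff (Or.inl hk0) (Or.inl hkt), editDistTo, iInf_lt_iff] at h
  obtain ⟨H, h⟩ := h
  obtain ⟨hH, h⟩ := iInf_lt_iff.1 h
  refine ⟨H, hH, ?_⟩
  rw [div_le_iff₀ (by positivity)]
  have h2 : ENNReal.ofReal ε * (k : ℝ≥0∞) ^ 2 = ENNReal.ofReal (ε * (k : ℝ) ^ 2) := by
    rw [ENNReal.ofReal_mul hε.le, ENNReal.ofReal_pow hk'.le, ENNReal.ofReal_natCast]
  rw [h2, ← ENNReal.ofReal_natCast] at h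
  exact ((ENNReal.ofReal_lt_ofReal_iff (by positivity)).1 h).le

theorem d1To_le_one {k : ℕ} (G : SimpleGraph (Fin k)) {P : GraphProperty}
    {H : SimpleGraph (Fin k)} (hH : P.Holds H) : d1To G P ≤ 1 := by
  have hcard : editDist G H ≤ k ^ 2 := by
    calc editDist G H ≤ Nat.card (Sym2 (Fin k)) := Set.ncard_le_card _
      _ ≤ Nat.card (Fin k × Fin k) := Nat.card_le_card_of_surjective _ Quot.mk_surjective
      _ = k ^ 2 := by simp [sq]
  rw [d1To, Nat.card_fin]
  refine ENNReal.div_le_of_le_mul ?_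
  rw [one_mul]
  exact (iInf₂_le H hH).trans (by exact_mod_cast hcard)

/-! ### Testable properties -/

theorem mem_closure_of_tendsto_lintegral_d1To {P : GraphProperty} {W : GraphFun}
    (h : Tendsto (fun k : ℕ => ∫⁻ ω : SampleSpace k, d1To (randomGraph k W ω) P ∂volume)
      atTop (𝓝 0)) : W ∈ P.closure := by
  refine GraphProperty.mem_closure_of_forall_exists fun ε hε K => ?_
  -- The sampling error is at most `e` and the edits add at most `2 * e`, hence `ε / 3`. The bad
  -- events have probability at most `1 / 2` and `1 / 4`, so some sample avoids both.
  have he : 0 < min (ε / 3) (1 / 2) := by positivity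
  set e := min (ε / 3) (1 / 2)
  have he1 : e ≤ ε / 3 := min_le_left _ _
  have he2 : e ≤ 1 / 2 := min_le_right _ _
  obtain ⟨k, hk, hkK, hk1, hkd⟩ := ((eventually_volume_real_cutNorm_le W he).and
    ((eventually_ge_atTop K).and ((eventually_gt_atTop 0).and
      (ENNReal.tendsto_nhds_zero.1 h (ENNReal.ofReal (e * (1 / 4)))
        (ENNReal.ofReal_pos.2 (by positivity)))))).exists
  have h0 : (volume : Measure (SampleSpace k)).real
      {ω | ENNReal.ofReal e ≤ d1To (randomGraph k W ω) P} ≤ 1 / 4 := by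
    refine ENNReal.toReal_le_of_le_ofReal (by norm_num) ?_
    refine (meas_ge_le_lintegral_div
      (measurable_comp_randomGraph W fun G => d1To G P).aemeasurable
      (ENNReal.ofReal_pos.2 he).ne' ENNReal.ofReal_ne_top).trans ?_
    refine ENNReal.div_le_of_le_mul (hkd.trans_eq ?_)
    rw [← ENNReal.ofReal_mul (by norm_num), mul_comm]
  obtain ⟨ω, h1, h2⟩ := nonempty_compl_union_of_measureReal (lt_of_le_of_lt
    (add_le_add hk h0) (by linarith))
  obtain ⟨π, hπ⟩ := not_not.1 h1
  obtain ⟨H, hH, hHd⟩ := exists_holds_of_d1To_lt hk1 (not_le.1 h2)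
  refine ⟨k, hkK, _, P.holds_comap_perm hH π,
    (cutNorm_ofGraph_comap_sub_le_add_editDist hk1 (randomGraph k W ω) H π W).trans ?_⟩
  rw [mul_div_assoc]
  linarith

/-- The graphs converging to `W` pass the test with frequency at least 2/3. Replacing injective
samples by samples with replacement, and then the graph by `W`, costs errors that vanish in the
limit. -/
theorem two_thirds_le_of_mem_closure {P P' : GraphProperty}
    (hP : ∀ {V : Type} [Finite V] (G : SimpleGraph V), P.Holds G →
      ∀ k : ℕ, 1 ≤ k → k ≤ Nat.card V → 2 / 3 ≤ inducedFraction k G P')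
    {W : GraphFun} (hW : W ∈ P.closure) {k : ℕ} (hk : 1 ≤ k) :
    2 / 3 ≤ (volume : Measure (SampleSpace k)).real {ω | P'.Holds (randomGraph k W ω)} := by
  obtain ⟨N, G, hG, hN, hd⟩ := hW
  obtain ⟨C, -, hC⟩ := abs_volume_real_randomGraph_sub_le k
  have hlim : Tendsto (fun m => 2 / 3 - (k : ℝ) ^ 2 / N m - C * cutDist (ofGraph (G m)) W) atTop
      (𝓝 (2 / 3 - 0 - C * 0)) :=
    (tendsto_const_nhds.sub (tendsto_const_nhds.div_atTop
      (tendsto_natCast_atTop_atTop.comp hN))).sub (hd.const_mul _)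
  rw [mul_zero, sub_zero, sub_zero] at hlim
  refine le_of_tendsto hlim ?_
  filter_upwards [hN.eventually_ge_atTop k] with m hm
  have : NeZero (N m) := ⟨by omega⟩
  have h1 := hP (G m) (hG m) k hk (by rwa [Nat.card_fin])
  have h2 := (abs_le.1 (abs_volume_real_randomGraph_ofGraph_sub_inducedFraction_le hm (G m) P')).1
  have h3 := (abs_le.1 (hC (ofGraph (G m)) W fun F => P'.Holds F)).2
  linarith

theorem tendsto_lintegral_d1To_of_mem_closure {P : GraphProperty} (hP : P.Testable) {W : GraphFun}
    (hW : W ∈ P.closure) :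
    Tendsto (fun k : ℕ => ∫⁻ ω : SampleSpace k, d1To (randomGraph k W ω) P ∂volume)
      atTop (𝓝 0) := by
  obtain ⟨P', hP1, hP2⟩ := hP
  refine ENNReal.tendsto_nhds_zero.2 fun ε' hε' => ?_
  obtain ⟨ε, hε, hεε'⟩ : ∃ ε : ℝ, 0 < ε ∧ ENNReal.ofReal (2 * ε) ≤ ε' := by
    obtain ⟨r, hr0, hr⟩ := ENNReal.lt_iff_exists_nnreal_btwn.1 hε'
    refine ⟨r / 2, half_pos (by exact_mod_cast hr0), ?_⟩
    rw [mul_div_cancel₀ _ two_ne_zero, ENNReal.ofReal_coe_nnreal]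
    exact hr.le
  obtain ⟨k, hk, hkε⟩ := hP2 ε hε
  obtain ⟨C, hC0, hC⟩ := abs_volume_real_randomGraph_sub_le k
  have hq := two_thirds_le_of_mem_closure hP1 hW hk
  -- Passing from `W` to the large sample, and then to sampling without replacement, loses at most
  -- `1 / 10` each time. The pass frequency stays at least `2/3 - 1/5`, which is above `1/3`.
  have he : 0 < min (min ε (1 / 2)) (1 / (10 * C)) := by positivity
  set e := min (min ε (1 / 2)) (1 / (10 * C))
  have he1 : e ≤ ε := (min_le_left _ _).trans (min_le_left _ _)
  have he2 : e ≤ 1 / 2 := (min_le_left _ _).trans (min_le_right _ _)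
  have he3 : C * e ≤ 1 / 10 := by
    have : e ≤ 1 / (10 * C) := min_le_right _ _
    calc C * e ≤ C * (1 / (10 * C)) := by gcongr
      _ = 1 / 10 := by field_simp
  have hlim : ∀ᶠ K : ℕ in atTop, (k : ℝ) ^ 2 / K < 1 / 10 :=
    (tendsto_const_nhds.div_atTop tendsto_natCast_atTop_atTop).eventually_lt_const (by norm_num)
  filter_upwards [eventually_volume_real_cutNorm_le W he, eventually_ge_atTop k, hlim]
    with K hK hkK hkK2
  have hK0 : 0 < K := by omega
  have : NeZero K := ⟨hK0.ne'⟩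
  let p : SimpleGraph (Fin K) → Prop := fun G => ¬ ∃ π : Equiv.Perm (Fin K),
    cutNorm (fun x y => (ofGraph (G.comap π)).toFun x y - W.toFun x y) ≤ e
  have hgood : ∀ G : SimpleGraph (Fin K), ¬ p G → d1To G P < ENNReal.ofReal ε := by
    intro G hG
    obtain ⟨π, hπ⟩ := not_not.1 hG
    have h1 := (abs_le.1 (hC (ofGraph (G.comap π)) W fun F => P'.Holds F)).1
    have h2 := (abs_le.1 (abs_volume_real_randomGraph_ofGraph_sub_inducedFraction_le hkK
      (G.comap π) P')).2
    rw [inducedFraction_comap] at h2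
    have h3 : C * cutDist (ofGraph (G.comap π)) W ≤ C * e :=
      mul_le_mul_of_nonneg_left ((cutDist_le_cutNorm _ _).trans hπ) hC0.le
    by_contra hcon
    have hed : ENNReal.ofReal (ε * (Nat.card (Fin K) : ℝ) ^ 2) ≤ editDistTo G P := by
      rw [ENNReal.ofReal_mul hε.le, ENNReal.ofReal_pow (Nat.cast_nonneg _),
        ENNReal.ofReal_natCast]
      exact ENNReal.mul_le_of_le_div (not_lt.1 hcon)
    have h4 := hkε G hed k le_rfl (by rwa [Nat.card_fin])
    linarith
  -- Without a member of `P` on `K` nodes the distance would be infinite, and even a rare bad event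
  -- would spoil the expectation. A single good sample supplies such a member, and its existence
  -- bounds the distance of every graph.
  have hone : ∀ G : SimpleGraph (Fin K), d1To G P ≤ 1 := by
    have hlt : (volume : Measure (SampleSpace K)).real {ω | p (randomGraph K W ω)} +
        (volume : Measure (SampleSpace K)).real ∅ < 1 := by
      rw [measureReal_empty]
      linarith [show (volume : Measure (SampleSpace K)).real {ω | p (randomGraph K W ω)} ≤ e from hK]
    obtain ⟨ω, hω, -⟩ := nonempty_compl_union_of_measureReal hlt
    obtain ⟨H, hH, -⟩ := exists_holds_of_d1To_lt hK0 (hgood _ hω)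
    exact fun G => d1To_le_one G hH
  have hmeas : MeasurableSet {ω : SampleSpace K | p (randomGraph K W ω)} :=
    measurableSet_randomGraph W p
  calc ∫⁻ ω : SampleSpace K, d1To (randomGraph K W ω) P ∂volume
      ≤ ∫⁻ ω : SampleSpace K, (ENNReal.ofReal ε +
          {ω | p (randomGraph K W ω)}.indicator 1 ω) ∂volume := by
        refine lintegral_mono fun ω => ?_
        by_cases hω : p (randomGraph K W ω)
        · rw [Set.indicator_of_mem (show ω ∈ {ω | p (randomGraph K W ω)} from hω)]
          exact (hone _).trans le_add_self
        · exact (hgood _ hω).le.trans le_self_add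
    _ = ENNReal.ofReal ε + volume {ω : SampleSpace K | p (randomGraph K W ω)} := by
        rw [lintegral_add_left measurable_const, lintegral_const, measure_univ, mul_one,
          lintegral_indicator_one hmeas]
    _ ≤ ENNReal.ofReal ε + ENNReal.ofReal ε := by
        refine add_le_add_right ?_ _
        rw [← ofReal_measureReal]
        exact ENNReal.ofReal_le_ofReal (le_trans hK he1)
    _ = ENNReal.ofReal (2 * ε) := by rw [← ENNReal.ofReal_add hε.le hε.le, two_mul]
    _ ≤ ε' := hεε'

end

theorem mainTheorem11 (P : GraphProperty) :
    (P.Hereditary →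
      P.closure = {W : GraphFun | ∀ k : ℕ, 1 ≤ k →
          (volume : Measure (SampleSpace k)) {ω | ¬ P.Holds (randomGraph k W ω)} = 0} ∧
      P.closure = {W : GraphFun | ∀ k : ℕ, 1 ≤ k → ∀ F : SimpleGraph (Fin k),
          ¬ P.Holds F → tInd F W = 0}) ∧
    (P.Testable →
      P.closure = {W : GraphFun |
        Tendsto (fun k : ℕ => ∫⁻ ω : SampleSpace k, d1To (randomGraph k W ω) P ∂volume)
          atTop (𝓝 0)}) := by
  refine ⟨fun hP => ?_, fun hP => Set.Subset.antisymm
    (fun W hW => tendsto_lintegral_d1To_of_mem_closure hP hW)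
    fun W hW => mem_closure_of_tendsto_lintegral_d1To hW⟩
  have hset : {W : GraphFun | ∀ k : ℕ, 1 ≤ k →
      (volume : Measure (SampleSpace k)) {ω | ¬ P.Holds (randomGraph k W ω)} = 0} =
      {W : GraphFun | ∀ k : ℕ, 1 ≤ k → ∀ F : SimpleGraph (Fin k), ¬ P.Holds F → tInd F W = 0} :=
    Set.ext fun W => forall₂_congr fun k _ => randomGraph_null_iff_tInd_eq_zero P W k
  have hcl : P.closure = {W : GraphFun | ∀ k : ℕ, 1 ≤ k → ∀ F : SimpleGraph (Fin k),
      ¬ P.Holds F → tInd F W = 0} :=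
    Set.Subset.antisymm (fun W hW k hk F hF => tInd_eq_zero_of_mem_closure hP hW hk hF)
      fun W hW => mem_closure_of_null (hset.symm ▸ hW : W ∈ {W : GraphFun | ∀ k : ℕ, 1 ≤ k →
        (volume : Measure (SampleSpace k)) {ω | ¬ P.Holds (randomGraph k W ω)} = 0})
  exact ⟨hcl.trans hset.symm, hcl⟩
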